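/- All spaces are real. Let $T>0$, $p\in[2,\infty)$. For a Banach space $V$ continuously and densely embedded in a Hilbert space $H$ put $\mathcal H=L^2(0,T;H)$, $\mathcal V=L^p(0,T;V)$, and identify $\mathcal V^*$ with $L^{p/(p-1)}(0,T;V^*)$ through $\langle z,v\rangle=\int_0^T\langle z(t),v(t)\rangle\,dt$, so that $\mathcal V\hookrightarrow\mathcal H\hookrightarrow\mathcal V^*$. Let $d/dt$ be the operator on $\mathcal V^*$ given by $\frac{d}{dt}z=\lim_{\tau\to0^+}\tau^{-1}(I-S(\tau))z$ (limit in $\mathcal V^*$), with domain $D(d/dt)$ the set of all $z$ for which the limit exists, where $S(\tau)z(t)=0$ for $t\le\tau$ and $S(\tau)z(t)=z(t-\tau)$ for $t>\tau$. A problem set $(V,H,M,\mathcal A)$, with $M:H\to H$ and $\mathcal A:\mathcal V\to\mathcal V^*$, is called proper if 1. $V$ is a separable, reflexive Banach space that is densely embedded in the Hilbert space $H$; 2. $M$ is linear, bounded, monotone and symmetric; 3. $\mathcal A$ maps bounded sets to bounded sets; there is $k:\mathcal V\to[0,\infty)$ with $\langle\mathcal Au-\mathcal Av,u-v\rangle\ge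 k(u-v)$ for all $u,v\in\mathcal V$; $\varepsilon\mapsto\langle\mathcal A(u+\varepsilon v),w\rangle$ is continuous on $[0,1]$ for all $u,v,w\in\mathcal V$; and $\langle\mathcal Au,u\rangle\to\infty$ as $\|u\|_{\mathcal V}\to\infty$. Put $(\mathcal Mu)(t)=Mu(t)$ and $\mathcal W=\{u\in\mathcal V:\mathcal Mu\in D(d/dt)\}$. Let $(V,H,M,\mathcal A)$ and $(V_\ell,H_\ell,M_\ell,\mathcal A_\ell)$, $\ell=1,\dots,q$, be proper problem sets (with the same $p,T$; the spaces induced by the latter are denoted $\mathcal H_\ell,\mathcal V_\ell,\mathcal W_\ell$), and let $E_\ell:H_\ell\to H$, $R_\ell:H\to H_\ell$ be bounded linear operators such that, for every $\ell$, $R_\ell E_\ell=I$ on $H_\ell$ and $(E_\ell u,v)_H=(u,R_\ell v)_{H_\ell}$ for all $u\in H_\ell$, $v\in H$, and such that $M=\sum_{\ell=1}^qE_\ell M_\ell R_\ell$. Let $\mathcal M_\ell$, $\mathcal E_\ell$, $\mathcal R_\ell$ be the operators induced pointwise in $t$ by $M_\ell$, $E_\ell$, $R_\ell$. For $f_\ell\in\mathcal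 V_\ell^*$ define the operator $\mathcal F_\ell:D(\mathcal F_\ell)\subseteq\mathcal H\to\mathcal H$ by $$D(\mathcal F_\ell)=\{u\in\mathcal H:\mathcal R_\ell u\in\mathcal W_\ell,\ (\tfrac{d}{dt}\mathcal M_\ell+\mathcal A_\ell)\mathcal R_\ell u+f_\ell\in\mathcal H_\ell\},\qquad \mathcal F_\ell u=\mathcal E_\ell\bigl((\tfrac{d}{dt}\mathcal M_\ell+\mathcal A_\ell)\mathcal R_\ell u+f_\ell\bigr).$$ Then each $\mathcal F_\ell$ is maximal accretive on $\mathcal H$, that is, $(\mathcal F_\ell u-\mathcal F_\ell v,u-v)_{\mathcal H}\ge0$ for all $u,v\in D(\mathcal F_\ell)$, and $sI+\mathcal F_\ell$ has range $\mathcal H$ for every $s>0$. Moreover, for all $s>0$ and $g\in\mathcal H$ there is a unique $u_\ell\in\mathcal W_\ell$ such that $(\frac{d}{dt}\mathcal M_\ell+\mathcal A_\ell)u_\ell+f_\ell\in\mathcal H_\ell$ and $su_\ell+(\frac{d}{dt}\mathcal M_\ell+\mathcal A_\ell)u_\ell+f_\ell=\mathcal R_\ell g$, and $u=\mathcal E_\ell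 u_\ell+s^{-1}(I-\mathcal E_\ell\mathcal R_\ell)g$ lies in $D(\mathcal F_\ell)$, satisfies $\mathcal R_\ell u=u_\ell$, and is the unique solution in $D(\mathcal F_\ell)$ of $(sI+\mathcal F_\ell)u=g$. -/

import Mathlib

open MeasureTheory Set Filter Topology
open scoped ENNReal NNReal RealInnerProductSpace

namespace AbstractCauchy

noncomputable section

/-! ### Possibly unbounded operators on a Hilbert space -/

/-- An operator `G : D(G) ⊆ E → E` is accretive if `(G u - G v, u - v) ≥ 0` on `D(G)`. -/
def IsAccretive {E : Type*} [NormedAddCommGroup E] [InnerProductSpace ℝ E]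
    (D : Set E) (G : D → E) : Prop :=
  ∀ u v : D, 0 ≤ ⟪G u - G v, (u : E) - (v : E)⟫

/-- An operator `G : D(G) ⊆ E → E` is maximal if the range of `s I + G` is `E` for all `s > 0`. -/
def IsMaximal {E : Type*} [NormedAddCommGroup E] [InnerProductSpace ℝ E]
    (D : Set E) (G : D → E) : Prop :=
  ∀ s : ℝ, 0 < s → Set.range (fun u : D => s • (u : E) + G u) = Set.univ

/-! ### Reflexive spaces and dense embeddings -/

/-- A Banach space is reflexive if the canonical map into its bidual is onto. -/
def IsReflexive (V : Type*) [NormedAddCommGroup V] [NormedSpace ℝ V] : Prop :=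
  Function.Surjective (NormedSpace.inclusionInDoubleDual ℝ V)

/-- A dense embedding: a continuous linear injection with dense range. -/
def IsDenseEmbedding {V H : Type*} [NormedAddCommGroup V] [NormedSpace ℝ V]
    [NormedAddCommGroup H] [InnerProductSpace ℝ H] (ι : V →L[ℝ] H) : Prop :=
  Function.Injective ι ∧ DenseRange ι

/-- For an embedding `ι : V → H`, the induced map `H → V*`, `h ↦ (h, ι ·)_H`. -/
def hilbertToDual {V H : Type*} [NormedAddCommGroup V] [NormedSpace ℝ V]
    [NormedAddCommGroup H] [InnerProductSpace ℝ H] (ι : V →L[ℝ] H) :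
    H →L[ℝ] StrongDual ℝ V :=
  LinearMap.mkContinuous
    { toFun := fun h => (innerSL ℝ h).comp ι
      map_add' := fun h k => by ext v; simp
      map_smul' := fun c h => by ext v; simp }
    ‖ι‖ (fun h => by
      refine (ContinuousLinearMap.opNorm_comp_le _ _).trans ?_
      rw [innerSL_apply_norm, mul_comm])

theorem hilbertToDual_apply {V H : Type*} [NormedAddCommGroup V] [NormedSpace ℝ V]
    [NormedAddCommGroup H] [InnerProductSpace ℝ H] (ι : V →L[ℝ] H) (h : H) (v : V) :
    hilbertToDual ι h v = ⟪h, ι v⟫ := rfl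

/-! ### Bochner spaces on `(0,T)` -/

/-- Lebesgue measure on `(0,T)`. -/
abbrev timeMeasure (T : ℝ) : Measure ℝ := volume.restrict (Ioo 0 T)

instance fact_one_le_ofReal (p : ℝ) [hp : Fact (2 ≤ p)] : Fact (1 ≤ ENNReal.ofReal p) :=
  ⟨ENNReal.one_le_ofReal.2 (by linarith [hp.out])⟩

instance fact_one_le_ofReal_conj (p : ℝ) [hp : Fact (2 ≤ p)] :
    Fact (1 ≤ ENNReal.ofReal (p / (p - 1))) :=
  ⟨ENNReal.one_le_ofReal.2 (by
    have h := hp.out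
    rw [le_div_iff₀ (by linarith)]; linarith)⟩

theorem two_le_ofReal (p : ℝ) [hp : Fact (2 ≤ p)] : (2 : ℝ≥0∞) ≤ ENNReal.ofReal p := by
  have h := ENNReal.ofReal_le_ofReal hp.out
  simpa using h

theorem ofReal_conj_le_two (p : ℝ) [hp : Fact (2 ≤ p)] :
    ENNReal.ofReal (p / (p - 1)) ≤ (2 : ℝ≥0∞) := by
  have h := hp.out
  have h2 : p / (p - 1) ≤ 2 := by
    rw [div_le_iff₀ (by linarith)]; linarith
  simpa using ENNReal.ofReal_le_ofReal h2

/-- `L²(0,T; H)`. -/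
abbrev SpaceH (T : ℝ) (H : Type*) [NormedAddCommGroup H] : Type _ :=
  Lp H 2 (timeMeasure T)

/-- `L^p(0,T; V)`. -/
abbrev SpaceV (p T : ℝ) (V : Type*) [NormedAddCommGroup V] : Type _ :=
  Lp V (ENNReal.ofReal p) (timeMeasure T)

/-- The dual of `L^p(0,T; V)`, in its standard identification with `L^{p/(p-1)}(0,T; V*)`. -/
abbrev SpaceVDual (p T : ℝ) (V : Type*) [NormedAddCommGroup V] [NormedSpace ℝ V] : Type _ :=
  Lp (StrongDual ℝ V) (ENNReal.ofReal (p / (p - 1))) (timeMeasure T)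

section Spaces

variable {p T : ℝ} {V H : Type*} [NormedAddCommGroup V] [NormedSpace ℝ V]
  [NormedAddCommGroup H] [InnerProductSpace ℝ H]

/-- The duality pairing `⟨z, v⟩ = ∫₀ᵀ ⟨z(t), v(t)⟩ dt`. -/
def pairing (z : SpaceVDual p T V) (v : SpaceV p T V) : ℝ :=
  ∫ t, (z t) (v t) ∂(timeMeasure T)

/-- The embedding `L^p(0,T; V) → L²(0,T; H)` induced by `ι : V → H`. -/
def embH [Fact (2 ≤ p)] (ι : V →L[ℝ] H) (v : SpaceV p T V) : SpaceH T H :=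
  AddSubgroup.inclusion (Lp.antitone (two_le_ofReal p)) (ι.compLp v)

/-- The embedding `L²(0,T; H) → L^{p/(p-1)}(0,T; V*)` induced by `ι : V → H`. -/
def embDual [Fact (2 ≤ p)] (ι : V →L[ℝ] H) (h : SpaceH T H) : SpaceVDual p T V :=
  AddSubgroup.inclusion (Lp.antitone (ofReal_conj_le_two p)) ((hilbertToDual ι).compLp h)

end Spaces

/-! ### The translation semigroup and its generator -/

/-- Right translation by `τ`, filled up by zero. -/
def shiftFun {F : Type*} [Zero F] (τ : ℝ) (u : ℝ → F) (t : ℝ) : F :=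
  if t ≤ τ then 0 else u (t - τ)

theorem memLp_shiftFun {F : Type*} [NormedAddCommGroup F] {r : ℝ≥0∞} {T : ℝ} (τ : ℝ≥0)
    {u : ℝ → F} (hu : MemLp u r (timeMeasure T)) :
    MemLp (shiftFun (τ : ℝ) u) r (timeMeasure T) := by
  have h1 : MemLp ((Ioo 0 T).indicator u) r volume :=
    (memLp_indicator_iff_restrict measurableSet_Ioo).2 hu
  have h2 : MemLp (fun t => (Ioo 0 T).indicator u (t - (τ : ℝ))) r volume :=
    h1.comp_measurePreserving (measurePreserving_sub_right volume (τ : ℝ))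
  refine (h2.restrict (Ioo 0 T)).ae_eq ?_
  refine (ae_restrict_iff' measurableSet_Ioo).2 (Eventually.of_forall fun t ht => ?_)
  have hτ : (0 : ℝ) ≤ τ := τ.2
  by_cases h : t ≤ (τ : ℝ)
  · have : t - (τ : ℝ) ∉ Ioo 0 T := fun hh => by linarith [hh.1]
    simp [shiftFun, h]
  · have : t - (τ : ℝ) ∈ Ioo 0 T := ⟨by linarith [not_le.1 h], by linarith [ht.2]⟩
    simp [shiftFun, h, indicator_of_mem this]

/-- The translation semigroup `S(τ)`, `τ ≥ 0`, on `L^r(0,T; F)`. -/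
def translation {F : Type*} [NormedAddCommGroup F] {r : ℝ≥0∞} {T : ℝ} (τ : ℝ≥0)
    (u : Lp F r (timeMeasure T)) : Lp F r (timeMeasure T) :=
  (memLp_shiftFun τ (Lp.memLp u)).toLp (shiftFun (τ : ℝ) u)

section TimeDerivative

variable {p T : ℝ} [Fact (2 ≤ p)] {V : Type*} [NormedAddCommGroup V] [NormedSpace ℝ V]

/-- `z` has time derivative `w`: `τ⁻¹ (I - S(τ)) z → w` in the dual space as `τ → 0+`. -/
def HasTimeDeriv (z w : SpaceVDual p T V) : Prop :=
  Tendsto (fun τ : ℝ≥0 => (τ : ℝ)⁻¹ • (z - translation τ z)) (𝓝[>] 0) (𝓝 w)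

/-- The domain `D(d/dt)`. -/
def timeDerivDomain (p T : ℝ) [Fact (2 ≤ p)] (V : Type*) [NormedAddCommGroup V]
    [NormedSpace ℝ V] : Set (SpaceVDual p T V) :=
  {z | ∃ w, HasTimeDeriv z w}

/-- The operator `d/dt : D(d/dt) ⊆ 𝒱* → 𝒱*`. -/
def timeDeriv (z : timeDerivDomain p T V) : SpaceVDual p T V := z.2.choose

theorem hasTimeDeriv_iff (z : timeDerivDomain p T V) (w : SpaceVDual p T V) :
    HasTimeDeriv (z : SpaceVDual p T V) w ↔ timeDeriv z = w :=
  ⟨fun h => tendsto_nhds_unique z.2.choose_spec h, fun h => h ▸ z.2.choose_spec⟩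

end TimeDerivative

/-! ### Properties of nonlinear operators from `𝒱 = L^p(0,T; V)` to its dual -/

section Operators

variable {p T : ℝ} [Fact (2 ≤ p)] {V : Type*} [NormedAddCommGroup V] [NormedSpace ℝ V]

/-- Bounded sets are mapped to bounded sets. -/
def IsBoundedOp (G : SpaceV p T V → SpaceVDual p T V) : Prop :=
  ∀ B : Set (SpaceV p T V), Bornology.IsBounded B → Bornology.IsBounded (G '' B)

/-- `⟨G u - G v, u - v⟩ ≥ k (u - v)`, where `k` takes values in `[0,∞)`. -/
def IsKMonotone (k : SpaceV p T V → ℝ≥0) (G : SpaceV p T V → SpaceVDual p T V) : Prop :=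
  ∀ u v, (k (u - v) : ℝ) ≤ pairing (G u - G v) (u - v)

/-- `ε ↦ ⟨G (u + ε v), w⟩` is continuous on `[0,1]`. -/
def IsHemicontinuous (G : SpaceV p T V → SpaceVDual p T V) : Prop :=
  ∀ u v w, ContinuousOn (fun ε : ℝ => pairing (G (u + ε • v)) w) (Icc 0 1)

/-- `⟨G u, u⟩ → ∞` as `‖u‖ → ∞`. -/
def IsCoercive (G : SpaceV p T V → SpaceVDual p T V) : Prop :=
  Tendsto (fun u => pairing (G u) u) (Bornology.cobounded (SpaceV p T V)) atTop

end Operators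

/-! ### Problem sets `(V, H, M, 𝒜)` -/

/-- The data of a problem set: the embedding `ι : V → H`, the operator `M : H → H` and the
operator `𝒜 : 𝒱 → 𝒱*`. -/
structure ProblemSet (p T : ℝ) (V H : Type*) [NormedAddCommGroup V] [NormedSpace ℝ V]
    [NormedAddCommGroup H] [InnerProductSpace ℝ H] where
  ι : V →L[ℝ] H
  M : H →L[ℝ] H
  A : SpaceV p T V → SpaceVDual p T V

namespace ProblemSet

variable {p T : ℝ} [Fact (2 ≤ p)] {V H : Type*} [NormedAddCommGroup V] [NormedSpace ℝ V]
  [NormedAddCommGroup H] [InnerProductSpace ℝ H]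

/-- Proper problem sets. (Linearity and boundedness of `M` are part of its type.) -/
structure IsProper (P : ProblemSet p T V H) : Prop where
  banach : CompleteSpace V
  hilbert : CompleteSpace H
  separable : TopologicalSpace.SeparableSpace V
  reflexive : IsReflexive V
  denseEmbedding : IsDenseEmbedding P.ι
  monotone_M : ∀ u : H, 0 ≤ ⟪P.M u, u⟫
  symmetric_M : ∀ u v : H, ⟪P.M u, v⟫ = ⟪P.M v, u⟫
  bounded_A : IsBoundedOp P.A
  kMonotone_A : ∃ k, IsKMonotone k P.A
  hemicontinuous_A : IsHemicontinuous P.A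
  coercive_A : IsCoercive P.A

/-- The space `𝒲 = {u ∈ 𝒱 : ℳ u ∈ D(d/dt)}`. -/
def spaceW (P : ProblemSet p T V H) : Set (SpaceV p T V) :=
  {u | embDual P.ι (P.M.compLp (embH P.ι u)) ∈ timeDerivDomain p T V}

/-- The operator `u ↦ (d/dt ℳ + 𝒜) u + f` from `𝒲` to `𝒱*`. -/
def cauchyOp (P : ProblemSet p T V H) (f : SpaceVDual p T V) (u : P.spaceW) : SpaceVDual p T V :=
  timeDeriv ⟨embDual P.ι (P.M.compLp (embH P.ι (u : SpaceV p T V))), u.2⟩ + P.A u + f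

/-- `u ∈ 𝓗` belongs to `𝒲`, and `(d/dt ℳ + 𝒜) u + f = h` belongs to `𝓗`. -/
def CauchyRel (P : ProblemSet p T V H) (f : SpaceVDual p T V) (u h : SpaceH T H) : Prop :=
  ∃ w : P.spaceW, embH P.ι (w : SpaceV p T V) = u ∧ P.cauchyOp f w = embDual P.ι h

/-- The domain `{u ∈ 𝒲 : (d/dt ℳ + 𝒜) u + f ∈ 𝓗}`, as a subset of `𝓗`. -/
def domain (P : ProblemSet p T V H) (f : SpaceVDual p T V) : Set (SpaceH T H) :=
  {u | ∃ h, P.CauchyRel f u h}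

/-- The restriction of `u ↦ (d/dt ℳ + 𝒜) u + f` to an operator in `𝓗`. -/
def restrictedOp (P : ProblemSet p T V H) (f : SpaceVDual p T V) (u : P.domain f) : SpaceH T H :=
  u.2.choose

end ProblemSet

theorem coeFn_embH {p T : ℝ} [Fact (2 ≤ p)] {V H : Type*} [NormedAddCommGroup V]
    [NormedSpace ℝ V] [NormedAddCommGroup H] [InnerProductSpace ℝ H] (ι : V →L[ℝ] H)
    (v : SpaceV p T V) : ∀ᵐ t ∂(timeMeasure T), embH ι v t = ι (v t) :=
  ι.coeFn_compLp v

theorem coeFn_embDual {p T : ℝ} [Fact (2 ≤ p)] {V H : Type*} [NormedAddCommGroup V]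
    [NormedSpace ℝ V] [NormedAddCommGroup H] [InnerProductSpace ℝ H] (ι : V →L[ℝ] H)
    (h : SpaceH T H) :
    ∀ᵐ t ∂(timeMeasure T), (embDual ι h : SpaceVDual p T V) t = hilbertToDual ι (h t) :=
  (hilbertToDual ι).coeFn_compLp h

theorem embH_injective {p T : ℝ} [Fact (2 ≤ p)] {V H : Type*} [NormedAddCommGroup V]
    [NormedSpace ℝ V] [NormedAddCommGroup H] [InnerProductSpace ℝ H] {ι : V →L[ℝ] H}
    (hι : IsDenseEmbedding ι) : Function.Injective (embH ι : SpaceV p T V → SpaceH T H) := by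
  intro u v huv
  apply Lp.ext
  filter_upwards [coeFn_embH ι u, coeFn_embH ι v] with t hu hv
  exact hι.1 (by rw [← hu, ← hv, huv])

theorem embDual_injective {p T : ℝ} [Fact (2 ≤ p)] {V H : Type*} [NormedAddCommGroup V]
    [NormedSpace ℝ V] [NormedAddCommGroup H] [InnerProductSpace ℝ H] {ι : V →L[ℝ] H}
    (hι : IsDenseEmbedding ι) :
    Function.Injective (embDual ι : SpaceH T H → SpaceVDual p T V) := by
  intro g h hgh
  apply Lp.ext
  filter_upwards [coeFn_embDual (p := p) ι g, coeFn_embDual (p := p) ι h] with t hg hh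
  have h1 : hilbertToDual ι (g t) = hilbertToDual ι (h t) := by rw [← hg, ← hh, hgh]
  have h2 : (fun x : H => ⟪g t, x⟫) = fun x : H => ⟪h t, x⟫ :=
    hι.2.equalizer (by fun_prop) (by fun_prop)
      (funext fun v => by
        simpa [hilbertToDual_apply] using congrArg (fun φ : StrongDual ℝ V => φ v) h1)
  exact ext_inner_right ℝ fun x => congrFun h2 x

/-- `restrictedOp` takes the value intended. -/
theorem ProblemSet.cauchyRel_iff {p T : ℝ} [Fact (2 ≤ p)] {V H : Type*} [NormedAddCommGroup V]
    [NormedSpace ℝ V] [NormedAddCommGroup H] [InnerProductSpace ℝ H] {P : ProblemSet p T V H}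
    (hι : IsDenseEmbedding P.ι) (f : SpaceVDual p T V) (u : P.domain f) (h : SpaceH T H) :
    P.CauchyRel f u h ↔ P.restrictedOp f u = h := by
  refine ⟨fun ⟨w, hw, hh⟩ => ?_, fun hh => hh ▸ u.2.choose_spec⟩
  obtain ⟨w', hw', hh'⟩ := u.2.choose_spec
  have : w' = w := Subtype.ext (embH_injective hι (hw'.trans hw.symm))
  subst this
  exact embDual_injective hι (hh'.symm.trans hh)

/-! ### The decomposition -/

/-- The standing assumption on the decomposition: the global and all local problem sets are
proper, `R_ℓ E_ℓ = I`, `(E_ℓ u, v)_H = (u, R_ℓ v)_{H_ℓ}`, and `M = ∑ E_ℓ M_ℓ R_ℓ`. -/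
structure IsDecomposition {p T : ℝ} [Fact (2 ≤ p)] {q : ℕ}
    {V H : Type*} [NormedAddCommGroup V] [NormedSpace ℝ V]
    [NormedAddCommGroup H] [InnerProductSpace ℝ H]
    {Vl Hl : Fin q → Type*} [∀ l, NormedAddCommGroup (Vl l)] [∀ l, NormedSpace ℝ (Vl l)]
    [∀ l, NormedAddCommGroup (Hl l)] [∀ l, InnerProductSpace ℝ (Hl l)]
    (P : ProblemSet p T V H) (Pl : ∀ l, ProblemSet p T (Vl l) (Hl l))
    (E : ∀ l, Hl l →L[ℝ] H) (R : ∀ l, H →L[ℝ] Hl l) : Prop where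
  proper : P.IsProper
  proper_local : ∀ l, (Pl l).IsProper
  restrict_extend : ∀ l (u : Hl l), R l (E l u) = u
  adjoint : ∀ l (u : Hl l) (v : H), ⟪E l u, v⟫ = ⟪u, R l v⟫
  sum_M : ∀ u : H, P.M u = ∑ l, E l ((Pl l).M (R l u))

section Decomposed

variable {p T : ℝ} [Fact (2 ≤ p)] {H V' H' : Type*}
  [NormedAddCommGroup H] [InnerProductSpace ℝ H] [NormedAddCommGroup V'] [NormedSpace ℝ V']
  [NormedAddCommGroup H'] [InnerProductSpace ℝ H']

/-- `D(F_ℓ) = {u ∈ 𝓗 : ℛ_ℓ u ∈ 𝒲_ℓ and (d/dt ℳ_ℓ + 𝒜_ℓ) ℛ_ℓ u + f_ℓ ∈ 𝓗_ℓ}`. -/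
def decomposedDomain (P' : ProblemSet p T V' H') (f' : SpaceVDual p T V') (R : H →L[ℝ] H') :
    Set (SpaceH T H) :=
  {u | R.compLp u ∈ P'.domain f'}

/-- `F_ℓ u = ℰ_ℓ ((d/dt ℳ_ℓ + 𝒜_ℓ) ℛ_ℓ u + f_ℓ)` for `u ∈ D(F_ℓ)`. -/
def decomposedOp (P' : ProblemSet p T V' H') (f' : SpaceVDual p T V') (E : H' →L[ℝ] H)
    (R : H →L[ℝ] H') (u : decomposedDomain P' f' R) : SpaceH T H :=
  E.compLp (P'.restrictedOp f' ⟨R.compLp (u : SpaceH T H), u.2⟩)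

end Decomposed

end

end AbstractCauchy

/-! Since `E` is the adjoint of `R` and `R E = I`, `E R` is an orthogonal projection and the
decomposed operator lives on its range. Accretivity is therefore inherited from the local operator.
The equation `s u + F u = g` splits into the local equation with right-hand side `R g` and the
trivial equation `s u = g` on the kernel of `R`. Uniqueness follows from accretivity and `s > 0`.

The local operator is accretive because `d/dt ℳ` is monotone: translation by `τ` can only decrease
`(ℳ u, u)`, so with `M` symmetric and monotone every difference quotient pairs nonnegatively with
`u` (`inner_sub_translation_nonneg`).

The substance is solvability of `d/dt ℳ u + B u = 0` with `B u = s u + 𝒜 u + f - g`, where `M` may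
have a kernel (`IsDegenerateSetting.exists_hasNegGenerator`). A minimax argument for finitely many
points of the monotone graph of `d/dt ℳ + B`, followed by weak compactness, yields `u` in a ball
with `⟨w + B v, v - u⟩ ≥ 0` for all `v` in that ball with `w = d/dt ℳ v`. Admissible `v` come from
the resolvents `J_σ` of the translation semigroup, which commute with `ℳ`. Positivity of `⟨B v, v⟩`
for large `v` puts `u` in the open ball. Testing with `J_σ (u + ε w)`, where `w` is a time-reversed
smooth element, moves the derivative onto the test element, because time reversal conjugates
translation into its adjoint. Letting `σ → 0` and then `ε → 0` gives the weak equation, which says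
that `ℳ u` is a resolvent value and hence lies in the domain of `d/dt`.

Two points need care. Weak limits in `L^p(0,T; V)` are obtained in the Hilbert space `L²(0,T; H)`
and lifted back (`hasWeakLimits_pairingL`). As `𝒜` is only known to grow linearly, `f` is handled by
approximating it by elements of `𝓗`, which the term `s u` absorbs (`exists_perturbedOp_pos`). -/

namespace AbstractCauchy

noncomputable section

/-! ### Contraction semigroups, their generators and resolvents -/

section Semigroup

variable {F G : Type*} [NormedAddCommGroup F] [NormedSpace ℝ F]
  [NormedAddCommGroup G] [NormedSpace ℝ G]

/-- A strongly continuous semigroup of linear contractions. -/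
structure IsContractionSemigroup (S : ℝ≥0 → F →L[ℝ] F) : Prop where
  zero : ∀ x, S 0 x = x
  add : ∀ a b x, S (a + b) x = S a (S b x)
  norm_le : ∀ a x, ‖S a x‖ ≤ ‖x‖
  continuous : ∀ x, Continuous fun a => S a x

/-- `z` lies in the domain of the negative generator of `S`, which maps it to `w`. -/
def HasNegGenerator (S : ℝ≥0 → F →L[ℝ] F) (z w : F) : Prop :=
  Tendsto (fun τ : ℝ≥0 => (τ : ℝ)⁻¹ • (z - S τ z)) (𝓝[>] 0) (𝓝 w)

/-- The resolvent `x ↦ ∫₀^∞ e^{-r} S(r) x dr`. -/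
def resolvent (S : ℝ≥0 → F →L[ℝ] F) (x : F) : F :=
  ∫ r in Ioi (0 : ℝ), Real.exp (-r) • S r.toNNReal x

/-- The semigroup with time rescaled by `σ`. -/
def rescale (S : ℝ≥0 → F →L[ℝ] F) (σ : ℝ≥0) (r : ℝ≥0) : F →L[ℝ] F := S (σ * r)

variable {S : ℝ≥0 → F →L[ℝ] F} {S' : ℝ≥0 → G →L[ℝ] G}

namespace IsContractionSemigroup

theorem rescale (hS : IsContractionSemigroup S) (σ : ℝ≥0) :
    IsContractionSemigroup (rescale S σ) where
  zero x := by simp [AbstractCauchy.rescale, hS.zero]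
  add a b x := by simp [AbstractCauchy.rescale, mul_add, hS.add]
  norm_le a x := hS.norm_le _ x
  continuous x := (hS.continuous x).comp (continuous_const.mul continuous_id)

theorem continuous_integrand (hS : IsContractionSemigroup S) (x : F) :
    Continuous fun r : ℝ => Real.exp (-r) • S r.toNNReal x :=
  (Real.continuous_exp.comp continuous_neg).smul ((hS.continuous x).comp continuous_real_toNNReal)

theorem norm_integrand_le (hS : IsContractionSemigroup S) (x : F) (r : ℝ) :
    ‖Real.exp (-r) • S r.toNNReal x‖ ≤ Real.exp (-r) * ‖x‖ := by
  rw [norm_smul, Real.norm_of_nonneg (Real.exp_pos _).le]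
  exact mul_le_mul_of_nonneg_left (hS.norm_le _ _) (Real.exp_pos _).le

theorem integrableOn_integrand (hS : IsContractionSemigroup S) (x : F) :
    IntegrableOn (fun r : ℝ => Real.exp (-r) • S r.toNNReal x) (Ioi 0) :=
  Integrable.mono' ((integrableOn_exp_neg_Ioi 0).mul_const ‖x‖)
    (hS.continuous_integrand x).aestronglyMeasurable
    (Eventually.of_forall (hS.norm_integrand_le x))

theorem norm_resolvent_le (hS : IsContractionSemigroup S) (x : F) : ‖resolvent S x‖ ≤ ‖x‖ := by
  refine (norm_integral_le_of_norm_le ((integrableOn_exp_neg_Ioi 0).mul_const ‖x‖)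
    (Eventually.of_forall (hS.norm_integrand_le x))).trans ?_
  rw [integral_mul_const, integral_exp_neg_Ioi_zero, one_mul]

theorem resolvent_sub (hS : IsContractionSemigroup S) (x y : F) :
    resolvent S (x - y) = resolvent S x - resolvent S y := by
  rw [resolvent, resolvent, resolvent,
    ← integral_sub (hS.integrableOn_integrand x) (hS.integrableOn_integrand y)]
  simp [smul_sub]

theorem resolvent_smul (c : ℝ) (x : F) : resolvent S (c • x) = c • resolvent S x := by
  rw [resolvent, resolvent, ← integral_smul]
  simp [smul_comm c]

theorem resolvent_neg (x : F) : resolvent S (-x) = -resolvent S x := by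
  simpa using resolvent_smul (S := S) (-1) x

theorem tendsto_resolvent {α : Type*} {l : Filter α} (hS : IsContractionSemigroup S)
    {g : α → F} {x : F} (hg : Tendsto g l (𝓝 x)) :
    Tendsto (fun a => resolvent S (g a)) l (𝓝 (resolvent S x)) := by
  rw [tendsto_iff_norm_sub_tendsto_zero] at hg ⊢
  refine squeeze_zero (fun _ => norm_nonneg _) (fun a => ?_) hg
  rw [← hS.resolvent_sub]
  exact hS.norm_resolvent_le _

variable [CompleteSpace F]

theorem map_resolvent [CompleteSpace G] (hS : IsContractionSemigroup S) (L : F →L[ℝ] G) (x : F) :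
    L (resolvent S x) = ∫ r in Ioi (0 : ℝ), Real.exp (-r) • L (S r.toNNReal x) := by
  rw [resolvent, ← L.integral_comp_comm (hS.integrableOn_integrand x)]
  simp

theorem map_resolvent_of_commute [CompleteSpace G] (hS : IsContractionSemigroup S)
    (L : F →L[ℝ] G) (hL : ∀ a x, L (S a x) = S' a (L x)) (x : F) :
    L (resolvent S x) = resolvent S' (L x) := by
  rw [hS.map_resolvent L x]
  simp only [hL, resolvent]

/-- The substitution `r ↦ r + τ` in the resolvent integral turns the orbit of a resolvent value into
an elementary function of `τ`, differentiable at `0`. -/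
theorem apply_resolvent_eq (hS : IsContractionSemigroup S) (τ : ℝ) (hτ : 0 ≤ τ) (x : F) :
    S τ.toNNReal (resolvent S x)
      = Real.exp τ • (resolvent S x - ∫ r in (0 : ℝ)..τ, Real.exp (-r) • S r.toNNReal x) := by
  have h1 : ∫ r in Ioi (0 : ℝ), Real.exp (-r) • S τ.toNNReal (S r.toNNReal x)
      = ∫ r in Ioi (0 : ℝ), Real.exp τ • (fun r => Real.exp (-r) • S r.toNNReal x) (r + τ) := by
    refine setIntegral_congr_fun measurableSet_Ioi fun r hr => ?_
    have hr' : (0 : ℝ) ≤ r := le_of_lt hr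
    simp only
    rw [← hS.add, add_comm r τ, Real.toNNReal_add hτ hr', smul_smul, ← Real.exp_add]
    congr 2
    ring
  have h2 := intervalIntegral.integral_interval_add_Ioi (f := fun r : ℝ =>
    Real.exp (-r) • S r.toNNReal x) (a := 0) (b := τ) (hS.integrableOn_integrand x)
    ((hS.integrableOn_integrand x).mono_set (Ioi_subset_Ioi hτ))
  have h3 := (measurePreserving_add_right volume τ).setIntegral_preimage_emb
    (measurableEmbedding_addRight τ) (fun r : ℝ => Real.exp (-r) • S r.toNNReal x) (Ioi τ)
  rw [preimage_add_const_Ioi, sub_self] at h3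
  rw [hS.map_resolvent (S τ.toNNReal) x, h1, integral_smul, h3]
  rw [resolvent, ← h2]
  simp

/-- Differentiation of the formula for `S(τ) J x` at `τ = 0`. With `A` the negative generator this
is `(I + A) J = I`. -/
theorem hasNegGenerator_resolvent (hS : IsContractionSemigroup S) (x : F) :
    HasNegGenerator S (resolvent S x) (x - resolvent S x) := by
  have h1 : HasDerivAt (fun τ : ℝ => Real.exp τ •
      (resolvent S x - ∫ r in (0 : ℝ)..τ, Real.exp (-r) • S r.toNNReal x))
      (resolvent S x - x) 0 := by
    have h2 : HasDerivAt (fun τ : ℝ => ∫ r in (0 : ℝ)..τ, Real.exp (-r) • S r.toNNReal x) x 0 := by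
      have := intervalIntegral.integral_hasDerivAt_right
        (f := fun r : ℝ => Real.exp (-r) • S r.toNNReal x) (a := 0) (b := 0) (by simp)
        ((hS.continuous_integrand x).stronglyMeasurableAtFilter _ _)
        (hS.continuous_integrand x).continuousAt
      simpa [hS.zero] using this
    have := (Real.hasDerivAt_exp 0).smul (h2.const_sub (resolvent S x))
    refine this.congr_deriv ?_
    simp [sub_eq_neg_add]
  have h3 := h1.tendsto_slope_zero_right
  have h4 : Tendsto (fun τ : ℝ≥0 => (τ : ℝ)) (𝓝[>] 0) (𝓝[>] 0) :=
    tendsto_nhdsWithin_iff.2 ⟨((NNReal.continuous_coe.tendsto' 0 0 (by simp)).mono_left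
      nhdsWithin_le_nhds), by
        filter_upwards [self_mem_nhdsWithin] with τ hτ
        exact NNReal.coe_pos.2 hτ⟩
  have h5 := (h3.comp h4).neg
  rw [neg_sub] at h5
  refine h5.congr fun τ => ?_
  have h6 := hS.apply_resolvent_eq (τ : ℝ) τ.2 x
  rw [Real.toNNReal_coe] at h6
  simp only [Function.comp, zero_add, ← h6]
  simp [← smul_neg]

end IsContractionSemigroup

theorem tendsto_const_mul_nhdsGT_zero {σ : ℝ≥0} (hσ : 0 < σ) :
    Tendsto (fun τ : ℝ≥0 => σ * τ) (𝓝[>] 0) (𝓝[>] 0) :=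
  tendsto_nhdsWithin_iff.2 ⟨((continuous_const.mul continuous_id).tendsto' 0 0 (by simp)).mono_left
    nhdsWithin_le_nhds, by
      filter_upwards [self_mem_nhdsWithin] with τ hτ
      exact mul_pos hσ hτ⟩

theorem HasNegGenerator.rescale {z w : F} (h : HasNegGenerator S z w) {σ : ℝ≥0} (hσ : 0 < σ) :
    HasNegGenerator (AbstractCauchy.rescale S σ) z ((σ : ℝ) • w) := by
  refine ((h.comp (tendsto_const_mul_nhdsGT_zero hσ)).const_smul (σ : ℝ)).congr fun τ => ?_
  have : (σ : ℝ) ≠ 0 := by positivity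
  simp only [Function.comp, AbstractCauchy.rescale, NNReal.coe_mul, smul_smul, mul_inv]
  rw [← mul_assoc, mul_inv_cancel₀ this, one_mul]

theorem HasNegGenerator.of_rescale {z w : F} {σ : ℝ≥0} (hσ : 0 < σ)
    (h : HasNegGenerator (AbstractCauchy.rescale S σ) z w) :
    HasNegGenerator S z ((σ : ℝ)⁻¹ • w) := by
  have := h.rescale (σ := σ⁻¹) (by positivity)
  convert this using 1
  · funext r
    simp only [AbstractCauchy.rescale]
    rw [← mul_assoc, mul_inv_cancel₀ hσ.ne', one_mul]
  · simp

namespace IsContractionSemigroup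

variable [CompleteSpace F]

/-- The resolvent of the semigroup `r ↦ S(σ r)`, whose negative generator is `σ A`, is `J_σ = (I + σ
A)⁻¹`; the value found here is the Yosida approximation. -/
theorem hasNegGenerator_resolvent_rescale (hS : IsContractionSemigroup S) {σ : ℝ≥0} (hσ : 0 < σ)
    (x : F) : HasNegGenerator S (resolvent (AbstractCauchy.rescale S σ) x)
      ((σ : ℝ)⁻¹ • (x - resolvent (AbstractCauchy.rescale S σ) x)) :=
  ((hS.rescale σ).hasNegGenerator_resolvent x).of_rescale hσ

/-- The other inverse relation `J (I + A) = I`: `J` is continuous and commutes with `S(τ)`, so it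
can be applied to the difference quotients before or after the limit. -/
theorem sub_resolvent_eq (hS : IsContractionSemigroup S) {z w : F} (h : HasNegGenerator S z w) :
    z - resolvent S z = resolvent S w := by
  refine tendsto_nhds_unique (hS.hasNegGenerator_resolvent z) ?_
  refine (hS.tendsto_resolvent h).congr fun τ => ?_
  rw [resolvent_smul, hS.resolvent_sub,
    ← hS.map_resolvent_of_commute (S' := S) (S τ) (fun a x => ?_)]
  rw [← hS.add, ← hS.add, add_comm]

theorem sub_resolvent_rescale_eq (hS : IsContractionSemigroup S) {z w : F}
    (h : HasNegGenerator S z w) {σ : ℝ≥0} (hσ : 0 < σ) :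
    z - resolvent (AbstractCauchy.rescale S σ) z
      = (σ : ℝ) • resolvent (AbstractCauchy.rescale S σ) w := by
  rw [(hS.rescale σ).sub_resolvent_eq (h.rescale hσ), resolvent_smul]

theorem tendsto_resolvent_rescale (hS : IsContractionSemigroup S) (x : F) :
    Tendsto (fun σ => resolvent (AbstractCauchy.rescale S σ) x) (𝓝[>] 0) (𝓝 x) := by
  have h1 : ∫ r in Ioi (0 : ℝ), Real.exp (-r) • x = x := by
    rw [integral_smul_const, integral_exp_neg_Ioi_zero, one_smul]
  conv => rhs; rw [← h1]
  refine tendsto_integral_filter_of_dominated_convergence (fun r => Real.exp (-r) * ‖x‖)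
    (Eventually.of_forall fun σ => ((hS.rescale σ).continuous_integrand x).aestronglyMeasurable)
    (Eventually.of_forall fun σ => Eventually.of_forall ((hS.rescale σ).norm_integrand_le x))
    ((integrableOn_exp_neg_Ioi 0).mul_const ‖x‖) (Eventually.of_forall fun r => ?_)
  refine Tendsto.const_smul (Tendsto.mono_left ?_ nhdsWithin_le_nhds) _
  refine ((hS.continuous x).comp (continuous_id.mul continuous_const)).tendsto' 0 x ?_
  simp [hS.zero]

end IsContractionSemigroup

end Semigroup

/-! ### Monotone graphs: solutions of variational inequalities -/

/-- A minimax statement for square matrices with nonnegative symmetric part. -/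
theorem exists_mem_stdSimplex_sum_nonneg {ι : Type*} [Fintype ι] [Nonempty ι] (a : ι → ι → ℝ)
    (ha : ∀ i j, 0 ≤ a i j + a j i) :
    ∃ c ∈ stdSimplex ℝ ι, ∀ i, 0 ≤ ∑ j, c j * a i j := by
  classical
  let L : (ι → ℝ) →L[ℝ] (ι → ℝ) :=
    LinearMap.toContinuousLinearMap (Matrix.mulVecLin (Matrix.of a))
  have hL : ∀ c i, L c i = ∑ j, c j * a i j := fun c i => by
    simp [L, Matrix.mulVec, dotProduct, mul_comm]
  by_contra! hcon
  have hdisj : Disjoint (L '' stdSimplex ℝ ι) (Ici 0) := by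
    rw [Set.disjoint_left]
    rintro _ ⟨c, hc, rfl⟩ hpos
    obtain ⟨i, hi⟩ := hcon c hc
    have := hpos i
    rw [hL] at this
    simp only [Pi.zero_apply] at this
    linarith
  -- If no weight vector works, the compact image of the simplex misses the nonnegative orthant and
  -- is strictly separated from it.
  obtain ⟨φ, u, v, h1, huv, h2⟩ := geometric_hahn_banach_compact_closed
    ((convex_stdSimplex ℝ ι).is_linear_image L.isLinear)
    ((isCompact_stdSimplex (𝕜 := ℝ) (ι := ι)).image L.continuous)
    (convex_Ici (𝕜 := ℝ) (0 : ι → ℝ)) isClosed_Ici hdisj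
  have hφ : ∀ y, φ y = ∑ i, y i * φ (Pi.single i 1) := fun y => by
    conv_lhs => rw [pi_eq_sum_univ' y, map_sum]
    refine Finset.sum_congr rfl fun i _ => ?_
    rw [map_smul, smul_eq_mul]
  have hv : v < 0 := by simpa using h2 0 (le_refl (0 : ι → ℝ))
  -- A negative coefficient would let a nonnegative multiple of a basis vector attain the value `v`
  -- exactly.
  have hμ : ∀ i, 0 ≤ φ (Pi.single i 1) := fun i => by
    by_contra! hi
    have h3 := h2 ((v / φ (Pi.single i 1)) • Pi.single i 1) (by
      intro j
      have : 0 < v / φ (Pi.single i 1) := div_pos_of_neg_of_neg hv hi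
      by_cases hj : j = i
      · subst hj; simpa using this.le
      · simp [hj])
    rw [map_smul, smul_eq_mul, div_mul_cancel₀ _ hi.ne] at h3
    exact lt_irrefl _ h3
  set μ : ι → ℝ := fun i => φ (Pi.single i 1) with hμdef
  have hsum : 0 < ∑ i, μ i := by
    refine lt_of_le_of_ne (Finset.sum_nonneg fun i _ => hμ i) fun h0 => ?_
    have h3 : ∀ i, μ i = 0 := fun i =>
      (Finset.sum_eq_zero_iff_of_nonneg fun i _ => hμ i).1 h0.symm i (Finset.mem_univ i)
    obtain ⟨c, hc⟩ : (stdSimplex ℝ ι).Nonempty := ⟨_, single_mem_stdSimplex ℝ (Classical.arbitrary ι)⟩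
    have h4 := h1 _ ⟨c, hc, rfl⟩
    rw [hφ] at h4
    simp only [hμdef] at h3
    simp [h3] at h4
    linarith
  -- At the normalised `μ` the functional must be negative; but up to a positive factor its value is
  -- the quadratic form of `a` at `μ`, which depends only on the symmetric part of `a`.
  have h5 := h1 _ ⟨fun i => (∑ i, μ i)⁻¹ * μ i, ⟨fun i => mul_nonneg (inv_nonneg.2 hsum.le) (hμ i),
    by rw [← Finset.mul_sum, inv_mul_cancel₀ hsum.ne']⟩, rfl⟩
  have h6 : 0 ≤ ∑ i, ∑ j, μ i * μ j * a i j := by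
    have h7 : ∑ i, ∑ j, μ i * μ j * a i j = ∑ i, ∑ j, μ i * μ j * a j i := by
      rw [Finset.sum_comm]
      exact Finset.sum_congr rfl fun i _ => Finset.sum_congr rfl fun j _ => by ring
    have h8 : 0 ≤ ∑ i, ∑ j, μ i * μ j * (a i j + a j i) :=
      Finset.sum_nonneg fun i _ => Finset.sum_nonneg fun j _ =>
        mul_nonneg (mul_nonneg (hμ i) (hμ j)) (ha i j)
    simp only [mul_add, Finset.sum_add_distrib] at h8
    linarith
  have h9 : φ (L fun i => (∑ i, μ i)⁻¹ * μ i) = (∑ i, μ i)⁻¹ * ∑ i, ∑ j, μ i * μ j * a i j := by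
    rw [hφ, Finset.mul_sum]
    refine Finset.sum_congr rfl fun i _ => ?_
    rw [hL, Finset.sum_mul, Finset.mul_sum]
    refine Finset.sum_congr rfl fun j _ => ?_
    simp only [hμdef]
    ring
  replace h5 := h9.symm.trans_lt h5
  have := mul_nonneg (inv_nonneg.2 hsum.le) h6
  linarith

section Variational

variable {X Y : Type*} [NormedAddCommGroup X] [NormedSpace ℝ X]
  [NormedAddCommGroup Y] [NormedSpace ℝ Y] (b : Y →L[ℝ] X →L[ℝ] ℝ)

/-- The graph `Γ` is monotone with respect to the pairing `b`. -/
def IsMonotoneGraph (Γ : Set (X × Y)) : Prop :=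
  ∀ z ∈ Γ, ∀ z' ∈ Γ, 0 ≤ b (z.2 - z'.2) (z.1 - z'.1)

/-- Bounded nets in `X` have limit points with respect to the topology induced by `b`. -/
def HasWeakLimits : Prop :=
  ∀ (R : ℝ) (U : Ultrafilter (Finset (X × Y))) (g : Finset (X × Y) → X), (∀ i, ‖g i‖ ≤ R) →
    ∃ u, ‖u‖ ≤ R ∧ ∀ y, Tendsto (fun i => b y (g i)) U (𝓝 (b y u))

variable {b}

/-- For the matrix `b y_i (x_i - x_j)`, monotonicity of the graph is exactly nonnegativity of the
symmetric part. The minimax weights `c` then give `u = ∑ c_j x_j`, which stays in the ball by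
convexity. -/
theorem IsMonotoneGraph.exists_finset {Γ : Set (X × Y)} (hΓ : IsMonotoneGraph b Γ) {R : ℝ}
    (hR : 0 ≤ R) (s : Finset (X × Y)) :
    ∃ u, ‖u‖ ≤ R ∧ ∀ z ∈ s, z ∈ Γ → ‖z.1‖ ≤ R → 0 ≤ b z.2 (z.1 - u) := by
  classical
  set t := s.filter fun z => z ∈ Γ ∧ ‖z.1‖ ≤ R with ht
  by_cases hne : t.Nonempty
  · have : Nonempty t := hne.to_subtype
    obtain ⟨c, hc, h⟩ := exists_mem_stdSimplex_sum_nonneg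
      (fun i j : t => b i.1.2 (i.1.1 - j.1.1)) (fun i j => by
        have := hΓ i.1 (Finset.mem_filter.1 i.2).2.1 j.1 (Finset.mem_filter.1 j.2).2.1
        simp only [map_sub, sub_apply] at this ⊢
        linarith)
    refine ⟨∑ j, c j • j.1.1, ?_, fun z hz h1 h2 => ?_⟩
    · refine (norm_sum_le _ _).trans ?_
      calc ∑ j, ‖c j • j.1.1‖ ≤ ∑ j, c j * R := Finset.sum_le_sum fun j _ => by
            rw [norm_smul, Real.norm_of_nonneg (hc.1 j)]
            exact mul_le_mul_of_nonneg_left (Finset.mem_filter.1 j.2).2.2 (hc.1 j)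
        _ = R := by rw [← Finset.sum_mul, hc.2, one_mul]
    · have h3 := h ⟨z, Finset.mem_filter.2 ⟨hz, h1, h2⟩⟩
      convert h3 using 1
      simp only [map_sub, mul_sub, Finset.sum_sub_distrib, ← Finset.sum_mul, hc.2, one_mul,
        map_sum, map_smul, smul_eq_mul]
  · refine ⟨0, by simpa using hR, fun z hz h1 h2 => ?_⟩
    exact absurd ⟨z, Finset.mem_filter.2 ⟨hz, h1, h2⟩⟩ hne

/-- Each inequality is affine in `u`, so it survives a weak limit of the solutions for finite
subsets, taken along an ultrafilter on the directed set of finite sets. -/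
theorem IsMonotoneGraph.exists_variational {Γ : Set (X × Y)} (hΓ : IsMonotoneGraph b Γ)
    (hb : HasWeakLimits b) {R : ℝ} (hR : 0 ≤ R) :
    ∃ u, ‖u‖ ≤ R ∧ ∀ z ∈ Γ, ‖z.1‖ ≤ R → 0 ≤ b z.2 (z.1 - u) := by
  classical
  choose g hg h using hΓ.exists_finset hR
  obtain ⟨u, hu, hlim⟩ := hb R (Ultrafilter.of atTop) g hg
  refine ⟨u, hu, fun z hz hzR => ?_⟩
  rw [map_sub]
  refine ge_of_tendsto (tendsto_const_nhds.sub (hlim z.2)) ?_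
  have : ∀ᶠ s : Finset (X × Y) in atTop, 0 ≤ b z.2 z.1 - b z.2 (g s) := by
    filter_upwards [eventually_ge_atTop {z}] with s hs
    have := h s z (hs (Finset.mem_singleton_self z)) hz hzR
    rwa [map_sub] at this
  exact Ultrafilter.of_le _ this

end Variational

/-! ### Monotone perturbations of degenerate generators -/

section Existence

variable {X Y : Type*} [NormedAddCommGroup X] [NormedSpace ℝ X]
  [NormedAddCommGroup Y] [NormedSpace ℝ Y]

/-- Monotonicity, hemicontinuity and boundedness of `B : X → Y` with respect to the pairing `b`. -/
structure IsMonotoneOp (b : Y →L[ℝ] X →L[ℝ] ℝ) (B : X → Y) : Prop where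
  mono : ∀ u v, 0 ≤ b (B u - B v) (u - v)
  hemi : ∀ u v w, ContinuousOn (fun ε : ℝ => b (B (u + ε • v)) w) (Icc 0 1)
  bdd : ∀ R : ℝ, ∃ C : ℝ, ∀ u, ‖u‖ ≤ R → ‖B u‖ ≤ C

variable {b : Y →L[ℝ] X →L[ℝ] ℝ} {B : X → Y}

theorem IsMonotoneOp.tendsto_hemi (hB : IsMonotoneOp b B) (u v w : X) :
    Tendsto (fun ε : ℝ => b (B (u + ε • v)) w) (𝓝[>] 0) (𝓝 (b (B u) w)) := by
  have h := hB.hemi u v w 0 (by simp)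
  simp only [ContinuousWithinAt, zero_smul, add_zero] at h
  refine h.mono_left ?_
  rw [← nhdsWithin_Ioc_eq_nhdsGT (zero_lt_one' ℝ)]
  exact nhdsWithin_mono _ Ioc_subset_Icc_self

theorem IsMonotoneOp.eventually_norm_le (hB : IsMonotoneOp b B) {α : Type*} {l : Filter α}
    {g : α → X} {x : X} (hg : Tendsto g l (𝓝 x)) : ∃ C : ℝ, ∀ᶠ a in l, ‖B (g a)‖ ≤ C := by
  obtain ⟨C, hC⟩ := hB.bdd (‖x‖ + 1)
  refine ⟨C, ?_⟩
  filter_upwards [hg.norm.eventually (eventually_le_nhds (lt_add_one ‖x‖))] with a ha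
  exact hC _ ha

theorem tendsto_apply_of_eventually_norm_le {α : Type*} {l : Filter α} {y : α → Y} {C : ℝ}
    (hC : ∀ᶠ a in l, ‖y a‖ ≤ C) {d : α → X} (hd : Tendsto d l (𝓝 0)) :
    Tendsto (fun a => b (y a) (d a)) l (𝓝 0) := by
  have h1 : Tendsto (fun a => ‖b‖ * C * ‖d a‖) l (𝓝 0) := by
    simpa using (tendsto_const_nhds (x := ‖b‖ * C)).mul hd.norm
  refine squeeze_zero_norm' ?_ h1
  filter_upwards [hC] with a ha
  refine (b.le_opNorm₂ _ _).trans ?_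
  gcongr

/-- Minty's trick: monotonicity is tested between `g a` and `z = x - ε w`. As `g a → x` with `B (g
a)` bounded, what remains is `b (B (g a)) w ≥ b (B z) w - o(1)`, and hemicontinuity makes `b (B z)
w` exceed `c` for a suitable `ε`. -/
theorem IsMonotoneOp.eventually_lt (hB : IsMonotoneOp b B) {α : Type*} {l : Filter α}
    {g : α → X} {x : X} (hg : Tendsto g l (𝓝 x)) (w : X) {c : ℝ} (hc : c < b (B x) w) :
    ∀ᶠ a in l, c < b (B (g a)) w := by
  obtain ⟨ε, hε, hlt⟩ : ∃ ε : ℝ, 0 < ε ∧ c < b (B (x + ε • -w)) w := by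
    have := (hB.tendsto_hemi x (-w) w).eventually (eventually_gt_nhds hc)
    obtain ⟨ε, h1, h2⟩ := (this.and self_mem_nhdsWithin).exists
    exact ⟨ε, h2, h1⟩
  obtain ⟨C, hC⟩ := hB.eventually_norm_le hg
  set z := x + ε • -w
  have hd : Tendsto (fun a => g a - x) l (𝓝 0) := by
    simpa using hg.sub_const x
  have h1 := (tendsto_apply_of_eventually_norm_le (b := b) hC hd).sub
    ((b (B z)).continuous.tendsto' 0 0 (map_zero _) |>.comp hd)
  have h2 : ∀ᶠ a in l, b (B (g a)) (g a - x) - b (B z) (g a - x)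
      < ε * (b (B z) w - c) := by
    refine h1.eventually (eventually_lt_nhds ?_)
    simpa using mul_pos hε (sub_pos.2 hlt)
  filter_upwards [h2] with a ha
  have h3 := hB.mono (g a) z
  have h4 : g a - z = (g a - x) + ε • w := by simp [z]; abel
  rw [h4] at h3
  simp only [map_sub, map_add, sub_apply, map_smul, smul_eq_mul] at h3 ha
  have h5 : ε * c < ε * b (B (g a)) w := by linarith
  exact lt_of_mul_lt_mul_left h5 hε.le

/-- Monotone hemicontinuous locally bounded operators are demicontinuous. -/
theorem IsMonotoneOp.tendsto (hB : IsMonotoneOp b B) {α : Type*} {l : Filter α}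
    {g : α → X} {x : X} (hg : Tendsto g l (𝓝 x)) (w : X) :
    Tendsto (fun a => b (B (g a)) w) l (𝓝 (b (B x) w)) := by
  refine tendsto_order.2 ⟨fun c hc => hB.eventually_lt hg w hc, fun c hc => ?_⟩
  have := hB.eventually_lt hg (-w) (c := -c) (by simpa using hc)
  filter_upwards [this] with a ha
  simpa using ha

theorem IsMonotoneOp.tendsto₂ (hB : IsMonotoneOp b B) {α : Type*} {l : Filter α}
    {g d : α → X} {x w : X} (hg : Tendsto g l (𝓝 x)) (hd : Tendsto d l (𝓝 w)) :
    Tendsto (fun a => b (B (g a)) (d a)) l (𝓝 (b (B x) w)) := by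
  obtain ⟨C, hC⟩ := hB.eventually_norm_le hg
  have h1 : Tendsto (fun a => d a - w) l (𝓝 0) := by simpa using hd.sub_const w
  have h2 := (hB.tendsto hg w).add (tendsto_apply_of_eventually_norm_le (b := b) hC h1)
  simpa using h2

/-- The setting of the abstract existence theorem: a degenerate operator `N : X → Y` commuting with
contraction semigroups on `X` and `Y`, which are adjoint to each other up to the reversal `ρ`. -/
structure IsDegenerateSetting (b : Y →L[ℝ] X →L[ℝ] ℝ) (S : ℝ≥0 → X →L[ℝ] X)
    (S' : ℝ≥0 → Y →L[ℝ] Y) (N : X →L[ℝ] Y) (ρ : X →L[ℝ] X) : Prop where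
  semigroup : IsContractionSemigroup S
  semigroup' : IsContractionSemigroup S'
  surjective_reversal : Function.Surjective ρ
  adjoint : ∀ τ y x, b (S' τ y) (ρ x) = b y (ρ (S τ x))
  commute : ∀ τ x, N (S τ x) = S' τ (N x)
  nonneg : ∀ x, 0 ≤ b (N x) x
  nonneg_sub : ∀ τ x, 0 ≤ b (N x - S' τ (N x)) x
  nondegenerate : ∀ y, (∀ x, b y x = 0) → y = 0
  weakLimits : HasWeakLimits b

namespace IsDegenerateSetting

variable {S : ℝ≥0 → X →L[ℝ] X} {S' : ℝ≥0 → Y →L[ℝ] Y} {N : X →L[ℝ] Y} {ρ : X →L[ℝ] X}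

theorem negGenerator_nonneg (h : IsDegenerateSetting b S S' N ρ) {v : X} {w : Y}
    (hw : HasNegGenerator S' (N v) w) : 0 ≤ b w v := by
  refine ge_of_tendsto ((b.flip v).continuous.tendsto w |>.comp hw) (Eventually.of_forall fun τ => ?_)
  simp only [Function.comp, ContinuousLinearMap.flip_apply, map_smul, smul_eq_mul]
  exact mul_nonneg (inv_nonneg.2 τ.2) (h.nonneg_sub τ v)

theorem _root_.AbstractCauchy.HasNegGenerator.sub {z z' w w' : Y} (hz : HasNegGenerator S' z w)
    (hz' : HasNegGenerator S' z' w') : HasNegGenerator S' (z - z') (w - w') := by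
  refine (Tendsto.sub hz hz').congr fun τ => ?_
  rw [map_sub, ← smul_sub]
  congr 1
  abel

theorem isMonotoneGraph (h : IsDegenerateSetting b S S' N ρ) (hB : IsMonotoneOp b B) :
    IsMonotoneGraph b {z : X × Y | HasNegGenerator S' (N z.1) (z.2 - B z.1)} := by
  intro z hz z' hz'
  have h1 := HasNegGenerator.sub hz hz'
  rw [← map_sub] at h1
  have h2 := h.negGenerator_nonneg h1
  have h3 := hB.mono z.1 z'.1
  simp only [map_sub, sub_apply] at h2 h3 ⊢
  linarith

variable [CompleteSpace X] [CompleteSpace Y]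

theorem map_resolvent (h : IsDegenerateSetting b S S' N ρ) (σ : ℝ≥0) (x : X) :
    N (resolvent (rescale S σ) x) = resolvent (rescale S' σ) (N x) :=
  (h.semigroup.rescale σ).map_resolvent_of_commute N (fun _ x => h.commute _ x) x

theorem adjoint_resolvent (h : IsDegenerateSetting b S S' N ρ) (σ : ℝ≥0) (y : Y) (x : X) :
    b (resolvent (rescale S' σ) y) (ρ x) = b y (ρ (resolvent (rescale S σ) x)) := by
  have h1 := (h.semigroup'.rescale σ).map_resolvent (b.flip (ρ x)) y
  have h2 := (h.semigroup.rescale σ).map_resolvent ((b y).comp ρ) x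
  simp only [ContinuousLinearMap.flip_apply, ContinuousLinearMap.comp_apply, rescale,
    h.adjoint] at h1 h2
  exact h1.trans h2.symm

/-- Because `N` intertwines the semigroups, `N J_σ x` is itself a resolvent value. Every `J_σ x` in
the ball is thus an admissible test element in the variational inequality. -/
theorem hasNegGenerator_map_resolvent (h : IsDegenerateSetting b S S' N ρ) {σ : ℝ≥0} (hσ : 0 < σ)
    (x : X) : HasNegGenerator S' (N (resolvent (rescale S σ) x))
      ((σ : ℝ)⁻¹ • N (x - resolvent (rescale S σ) x)) := by
  rw [map_sub, h.map_resolvent]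
  exact h.semigroup'.hasNegGenerator_resolvent_rescale hσ (N x)

variable {u : X} {R : ℝ}

/-- The variational inequality tested with `J_σ x`. -/
theorem variational_resolvent (h : IsDegenerateSetting b S S' N ρ)
    (hu : ∀ v w, HasNegGenerator S' (N v) w → ‖v‖ ≤ R → 0 ≤ b (w + B v) (v - u))
    {σ : ℝ≥0} (hσ : 0 < σ) {x : X} (hx : ‖x‖ ≤ R) :
    0 ≤ (σ : ℝ)⁻¹ * b (N (x - resolvent (rescale S σ) x)) (x - u)
      + b (B (resolvent (rescale S σ) x)) (resolvent (rescale S σ) x - u) := by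
  set v := resolvent (rescale S σ) x with hv
  have h1 := hu v _ (h.hasNegGenerator_map_resolvent hσ x)
    (((h.semigroup.rescale σ).norm_resolvent_le x).trans hx)
  rw [map_add, add_apply, map_smul, smul_apply, smul_eq_mul] at h1
  -- Replacing `v - u` by `x - u` in the derivative term only adds the nonnegative quantity `b (N (x
  -- - v)) (x - v)`.
  have h2 := h.nonneg (x - v)
  have h3 : b (N (x - v)) (v - u) = b (N (x - v)) (x - u) - b (N (x - v)) (x - v) := by
    rw [← map_sub]; congr 1; abel
  rw [h3, mul_sub] at h1
  have h4 : 0 ≤ (σ : ℝ)⁻¹ * b (N (x - v)) (x - v) := mul_nonneg (inv_nonneg.2 σ.2) h2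
  linarith

/-- Otherwise `u` lies on the sphere. Testing with `J_σ ((1 - ε) u)` and discarding the derivative
term, whose sign is favourable, gives `b (B u) u ≤ 0` after `σ → 0` and `ε → 0`, against coercivity.
-/
theorem norm_lt_of_variational (h : IsDegenerateSetting b S S' N ρ) (hB : IsMonotoneOp b B)
    (hu : ∀ v w, HasNegGenerator S' (N v) w → ‖v‖ ≤ R → 0 ≤ b (w + B v) (v - u))
    (huR : ‖u‖ ≤ R) (hcoer : ∀ v, R ≤ ‖v‖ → 0 < b (B v) v) : ‖u‖ < R := by
  by_contra! hle
  have key : ∀ ε ∈ Ioo (0 : ℝ) 1, b (B (u + ε • -u)) u ≤ 0 := by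
    intro ε hε
    set x := u + ε • -u with hx
    have hx' : x = (1 - ε) • u := by rw [hx, sub_smul, one_smul, smul_neg, sub_eq_add_neg]
    have hxR : ‖x‖ ≤ R := by
      rw [hx', norm_smul, Real.norm_of_nonneg (by linarith [hε.2])]
      exact (mul_le_of_le_one_left (norm_nonneg _) (by linarith [hε.1])).trans huR
    have hxu : x - u = -(ε • u) := by rw [hx]; simp
    have h1 : ∀ᶠ σ : ℝ≥0 in 𝓝[>] 0,
        0 ≤ b (B (resolvent (rescale S σ) x)) (resolvent (rescale S σ) x - u) := by
      filter_upwards [self_mem_nhdsWithin] with σ hσ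
      have hσ' : (0 : ℝ) < σ := hσ
      have h2 := h.variational_resolvent hu hσ hxR
      have h3 := h.negGenerator_nonneg (h.hasNegGenerator_map_resolvent hσ x)
      set v := resolvent (rescale S σ) x with hv
      rw [map_smul, smul_apply, smul_eq_mul] at h3
      have h4 := h.nonneg (x - v)
      have h5 : 0 ≤ b (N (x - v)) v := nonneg_of_mul_nonneg_right h3 (inv_pos.2 hσ')
      -- Splitting `x = (x - v) + v` uses both positivity properties, that of `N` and that of its
      -- derivative. As `x` is a positive multiple of `u`, the sign passes to `u`.
      have h6 : 0 ≤ b (N (x - v)) x := by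
        have : b (N (x - v)) x = b (N (x - v)) (x - v) + b (N (x - v)) v := by
          rw [← map_add]; congr 1; abel
        linarith
      have h7 : b (N (x - v)) x = (1 - ε) * b (N (x - v)) u := by
        conv_lhs => rw [hx', map_smul]
        rw [smul_eq_mul, ← hx']
      have h8 : 0 ≤ b (N (x - v)) u :=
        nonneg_of_mul_nonneg_right (h7 ▸ h6) (by linarith [hε.2])
      rw [hxu, map_neg, map_smul, smul_eq_mul] at h2
      have h9 : 0 ≤ (σ : ℝ)⁻¹ * (ε * b (N (x - v)) u) :=
        mul_nonneg (inv_nonneg.2 hσ'.le) (mul_nonneg hε.1.le h8)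
      rw [mul_neg] at h2
      linarith
    have h2 := h.semigroup.tendsto_resolvent_rescale x
    have h3 := ge_of_tendsto (hB.tendsto₂ h2 (h2.sub_const u)) h1
    rw [hxu, map_neg, map_smul, smul_eq_mul] at h3
    by_contra! hpos
    have := mul_pos hε.1 hpos
    linarith
  have h1 : b (B u) u ≤ 0 := le_of_tendsto (hB.tendsto_hemi u (-u) u) (by
    filter_upwards [Ioo_mem_nhdsGT (zero_lt_one' ℝ)] with ε hε using key ε hε)
  exact absurd h1 (not_le.2 (hcoer u hle))

/-- The inequality form of the weak equation, tested with the reversed smooth element `w = ρ (J y)`.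
Since `u` is interior, `u + ε w` stays in the ball for small `ε`. -/
theorem weak_equation_nonneg (h : IsDegenerateSetting b S S' N ρ) (hB : IsMonotoneOp b B)
    (hu : ∀ v w, HasNegGenerator S' (N v) w → ‖v‖ ≤ R → 0 ≤ b (w + B v) (v - u))
    (huR : ‖u‖ < R) (y : X) :
    0 ≤ b (N u) (ρ (y - resolvent S y)) + b (B u) (ρ (resolvent S y)) := by
  set w := ρ (resolvent S y) with hw
  have key : ∀ᶠ ε : ℝ in 𝓝[>] 0,
      0 ≤ b (N (u + ε • w)) (ρ (y - resolvent S y)) + b (B (u + ε • w)) w := by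
    have h0 : ∀ᶠ ε : ℝ in 𝓝[>] 0, ‖u + ε • w‖ < R := by
      have : Tendsto (fun ε : ℝ => ‖u + ε • w‖) (𝓝 0) (𝓝 ‖u‖) :=
        (continuous_const.add (continuous_id.smul continuous_const)).norm.tendsto' _ _ (by simp)
      exact (this.mono_left nhdsWithin_le_nhds).eventually (eventually_lt_nhds huR)
    filter_upwards [h0, self_mem_nhdsWithin] with ε hxR hε
    have hε' : 0 < ε := hε
    set x := u + ε • w with hx
    have hxu : x - u = ε • w := by rw [hx]; simp
    have h1 : ∀ᶠ σ : ℝ≥0 in 𝓝[>] 0,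
        0 ≤ ε * b (N x) (ρ (resolvent (rescale S σ) (y - resolvent S y)))
          + b (B (resolvent (rescale S σ) x)) (resolvent (rescale S σ) x - u) := by
      filter_upwards [self_mem_nhdsWithin] with σ hσ
      have hσ' : (0 : ℝ) < σ := hσ
      have h2 := h.variational_resolvent hu hσ hxR.le
      -- Adjointness moves `I - J_σ` onto `J y`, where it equals `σ J_σ` applied to the generator
      -- value `y - J y`. The factor `σ` cancels the singular `σ⁻¹`.
      have h3 : b (N (x - resolvent (rescale S σ) x)) w
          = σ * b (N x) (ρ (resolvent (rescale S σ) (y - resolvent S y))) := by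
        rw [map_sub, h.map_resolvent, map_sub, sub_apply, hw, h.adjoint_resolvent,
          ← map_sub, ← map_sub, h.semigroup.sub_resolvent_rescale_eq
            (h.semigroup.hasNegGenerator_resolvent y) hσ, map_smul, map_smul, smul_eq_mul]
      rw [hxu, map_smul, smul_eq_mul, h3] at h2
      convert h2 using 2
      field_simp
    have h2 := h.semigroup.tendsto_resolvent_rescale x
    have h3 := ((((b (N x)).comp ρ).continuous.tendsto _).comp
      (h.semigroup.tendsto_resolvent_rescale (y - resolvent S y))).const_mul ε
    have h4 := ge_of_tendsto (h3.add (hB.tendsto₂ h2 (h2.sub_const u))) h1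
    rw [hxu, map_smul, smul_eq_mul, ← mul_add] at h4
    exact nonneg_of_mul_nonneg_right h4 hε'
  refine ge_of_tendsto (Tendsto.add ?_ (hB.tendsto_hemi u w w)) key
  refine Tendsto.mono_left ?_ nhdsWithin_le_nhds
  refine Continuous.tendsto' ?_ _ _ (by simp)
  exact ((b.flip _).comp N).continuous.comp
    (continuous_const.add (continuous_id.smul continuous_const))

/-- Solvability of the degenerate evolution equation `(d/dt) N u + B u = 0`. -/
theorem exists_hasNegGenerator (h : IsDegenerateSetting b S S' N ρ) (hB : IsMonotoneOp b B)
    (hR : 0 ≤ R) (hcoer : ∀ v, R ≤ ‖v‖ → 0 < b (B v) v) :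
    ∃ u, HasNegGenerator S' (N u) (-B u) := by
  obtain ⟨u, huR, hu⟩ := (h.isMonotoneGraph hB).exists_variational h.weakLimits hR
  have hu' : ∀ v w, HasNegGenerator S' (N v) w → ‖v‖ ≤ R → 0 ≤ b (w + B v) (v - u) :=
    fun v w hw hv => hu (v, w + B v) (by simpa using hw) hv
  have hlt := h.norm_lt_of_variational hB hu' huR hcoer
  refine ⟨u, ?_⟩
  -- The inequality is odd in `y`, so using it for `y` and `-y` yields equality.
  have h1 : ∀ y, b (N u) (ρ (y - resolvent S y)) + b (B u) (ρ (resolvent S y)) = 0 := fun y => by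
    have h2 := h.weak_equation_nonneg hB hu' hlt y
    have h3 := h.weak_equation_nonneg hB hu' hlt (-y)
    rw [IsContractionSemigroup.resolvent_neg, ← neg_sub', map_neg, map_neg, map_neg, map_neg] at h3
    linarith
  have hres : ∀ (z : Y) (x : X), b (resolvent S' z) (ρ x) = b z (ρ (resolvent S x)) := fun z x => by
    have := h.adjoint_resolvent 1 z x
    have e1 : rescale S 1 = S := by funext r; simp [rescale]
    have e2 : rescale S' 1 = S' := by funext r; simp [rescale]
    rwa [e1, e2] at this
  -- Transposing the resolvent, the weak equation reads `N u = J' (N u - B u)`. Resolvent values lie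
  -- in the domain of the generator, which here takes the value `-B u`.
  have h2 : N u = resolvent S' (N u - B u) := by
    refine sub_eq_zero.1 (h.nondegenerate _ fun x => ?_)
    obtain ⟨x, rfl⟩ := h.surjective_reversal x
    have := h1 x
    rw [map_sub, sub_apply, hres]
    simp only [map_sub, sub_apply] at this ⊢
    linarith
  have h3 := h.semigroup'.hasNegGenerator_resolvent (N u - B u)
  rw [← h2] at h3
  simpa using h3

end IsDegenerateSetting

end Existence

/-! ### Translations as a contraction semigroup -/

section Translation

variable {F : Type*} [NormedAddCommGroup F] {r : ℝ≥0∞} {T : ℝ}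

/-- On `(0,T)` the truncated shift is an honest translate of the zero extension to the line, so
facts about translations of `ℝ` apply. -/
theorem shiftFun_of_mem (τ : ℝ≥0) (u : ℝ → F) {t : ℝ} (ht : t ∈ Ioo 0 T) :
    shiftFun (τ : ℝ) u t = (Ioo 0 T).indicator u (t - τ) := by
  have hτ : (0 : ℝ) ≤ τ := τ.2
  by_cases h : t ≤ (τ : ℝ)
  · have : t - (τ : ℝ) ∉ Ioo 0 T := fun hh => by linarith [hh.1]
    simp [shiftFun, h]
  · have : t - (τ : ℝ) ∈ Ioo 0 T := ⟨by linarith [not_le.1 h], by linarith [ht.2]⟩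
    simp [shiftFun, h, indicator_of_mem this]

theorem coeFn_translation (τ : ℝ≥0) (u : Lp F r (timeMeasure T)) :
    translation τ u =ᵐ[timeMeasure T] shiftFun (τ : ℝ) u :=
  MemLp.coeFn_toLp _

theorem ae_shift (τ : ℝ≥0) {q : ℝ → Prop} (hq : ∀ᵐ t ∂timeMeasure T, q t) :
    ∀ᵐ t ∂timeMeasure T, (τ : ℝ) < t → q (t - τ) := by
  rw [ae_restrict_iff' measurableSet_Ioo] at hq ⊢
  have h := (measurePreserving_sub_right volume (τ : ℝ)).quasiMeasurePreserving.ae hq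
  filter_upwards [h] with t ht h1 h2
  exact ht ⟨by linarith, by linarith [h1.2, τ.2]⟩

theorem shiftFun_ae_congr (τ : ℝ≥0) {u v : ℝ → F} (h : u =ᵐ[timeMeasure T] v) :
    shiftFun (τ : ℝ) u =ᵐ[timeMeasure T] shiftFun (τ : ℝ) v := by
  filter_upwards [ae_shift τ h] with t ht
  by_cases h1 : t ≤ (τ : ℝ)
  · simp [shiftFun, h1]
  · simp [shiftFun, h1, ht (not_le.1 h1)]

variable (F r T) in
theorem translation_zero (u : Lp F r (timeMeasure T)) : translation 0 u = u := by
  apply Lp.ext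
  filter_upwards [coeFn_translation 0 u, ae_restrict_mem measurableSet_Ioo] with t h1 h2
  simp [h1, shiftFun, not_le.2 h2.1]

theorem translation_translation (a b : ℝ≥0) (u : Lp F r (timeMeasure T)) :
    translation (a + b) u = translation a (translation b u) := by
  apply Lp.ext
  filter_upwards [coeFn_translation (a + b) u, coeFn_translation a (translation b u),
    shiftFun_ae_congr a (coeFn_translation b u)] with t h1 h2 h3
  rw [h1, h2, h3]
  have hab : ((a + b : ℝ≥0) : ℝ) = a + b := NNReal.coe_add a b
  have hb : (0 : ℝ) ≤ b := b.2
  simp only [shiftFun]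
  by_cases h4 : t ≤ (a : ℝ)
  · rw [if_pos h4, if_pos (by rw [hab]; linarith)]
  · rw [if_neg h4]
    exact if_congr (by rw [hab, sub_le_iff_le_add']) rfl (by rw [hab, sub_sub])

theorem translation_add (τ : ℝ≥0) (u v : Lp F r (timeMeasure T)) :
    translation τ (u + v) = translation τ u + translation τ v := by
  apply Lp.ext
  filter_upwards [coeFn_translation τ (u + v), coeFn_translation τ u, coeFn_translation τ v,
    Lp.coeFn_add (translation τ u) (translation τ v), shiftFun_ae_congr τ (Lp.coeFn_add u v)]
    with t h1 h2 h3 h4 h5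
  rw [h1, h4, Pi.add_apply, h2, h3, h5]
  simp only [shiftFun]
  split_ifs <;> simp

theorem translation_smul [NormedSpace ℝ F] (τ : ℝ≥0) (c : ℝ) (u : Lp F r (timeMeasure T)) :
    translation τ (c • u) = c • translation τ u := by
  apply Lp.ext
  filter_upwards [coeFn_translation τ (c • u), coeFn_translation τ u,
    Lp.coeFn_smul c (translation τ u), shiftFun_ae_congr τ (Lp.coeFn_smul c u)]
    with t h1 h2 h3 h4
  rw [h1, h3, Pi.smul_apply, h2, h4]
  simp only [shiftFun]
  split_ifs <;> simp

theorem translation_compLp {G : Type*} [NormedAddCommGroup G] [NormedSpace ℝ F] [NormedSpace ℝ G]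
    (L : F →L[ℝ] G) (τ : ℝ≥0) (u : Lp F r (timeMeasure T)) :
    translation τ (L.compLp u) = L.compLp (translation τ u) := by
  apply Lp.ext
  filter_upwards [coeFn_translation τ (L.compLp u), coeFn_translation τ u,
    L.coeFn_compLp (translation τ u), shiftFun_ae_congr τ (L.coeFn_compLp u)]
    with t h1 h2 h3 h4
  rw [h1, h3, h2, h4]
  simp only [shiftFun]
  split_ifs <;> simp

theorem memLp_indicator_coeFn (u : Lp F r (timeMeasure T)) :
    MemLp ((Ioo 0 T).indicator u) r volume :=
  (memLp_indicator_iff_restrict measurableSet_Ioo).2 (Lp.memLp u)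

theorem norm_translation_le (τ : ℝ≥0) (u : Lp F r (timeMeasure T)) :
    ‖translation τ u‖ ≤ ‖u‖ := by
  rw [Lp.norm_def, Lp.norm_def]
  refine ENNReal.toReal_mono (Lp.eLpNorm_ne_top u) ?_
  have h1 : translation τ u =ᵐ[timeMeasure T] (Ioo 0 T).indicator u ∘ fun t => t - (τ : ℝ) := by
    filter_upwards [coeFn_translation τ u, ae_restrict_mem measurableSet_Ioo] with t h1 h2
    rw [h1, shiftFun_of_mem τ u h2, Function.comp]
  rw [eLpNorm_congr_ae h1]
  refine (eLpNorm_restrict_le _ _ _ _).trans ?_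
  rw [eLpNorm_comp_measurePreserving (memLp_indicator_coeFn u).1
    (measurePreserving_sub_right volume (τ : ℝ)), eLpNorm_indicator_eq_eLpNorm_restrict
      measurableSet_Ioo]

variable [NormedSpace ℝ F] [Fact (1 ≤ r)]

variable (F r T) in
/-- The translation semigroup as a family of bounded operators. -/
def translationL (τ : ℝ≥0) : Lp F r (timeMeasure T) →L[ℝ] Lp F r (timeMeasure T) :=
  LinearMap.mkContinuous
    { toFun := translation τ
      map_add' := translation_add τ
      map_smul' := translation_smul τ } 1 fun u => by
    rw [one_mul]
    exact norm_translation_le τ u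

@[simp]
theorem translationL_apply (τ : ℝ≥0) (u : Lp F r (timeMeasure T)) :
    translationL F r T τ u = translation τ u := rfl

/-- Strong continuity of translations on `L^r(ℝ)`, for finite `r`, restricted to `(0,T)`. -/
theorem continuous_translation (hr : r ≠ ∞) (u : Lp F r (timeMeasure T)) :
    Continuous fun τ : ℝ≥0 => translation τ u := by
  set U : Lp F r (volume : Measure ℝ) := (memLp_indicator_coeFn u).toLp _ with hU
  let g : C(ℝ≥0, C(ℝ, ℝ)) :=
    (ContinuousMap.mk (fun z : ℝ≥0 × ℝ => z.2 - (z.1 : ℝ)) (by fun_prop)).curry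
  have h1 : Continuous fun τ : ℝ≥0 => Lp.compMeasurePreserving (g τ)
      (measurePreserving_sub_right volume (τ : ℝ)) U :=
    continuous_const.compMeasurePreservingLp g.continuous _ hr
  refine ((LpToLpRestrictCLM ℝ F ℝ volume r (Ioo 0 T)).continuous.comp h1).congr fun τ => ?_
  apply Lp.ext
  have h2 : Lp.compMeasurePreserving (g τ) (measurePreserving_sub_right volume (τ : ℝ)) U
      =ᵐ[volume] fun t => (Ioo 0 T).indicator u (t - τ) :=
    (Lp.coeFn_compMeasurePreserving U _).trans
      ((measurePreserving_sub_right volume (τ : ℝ)).quasiMeasurePreserving.ae_eq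
        (memLp_indicator_coeFn u).coeFn_toLp)
  filter_upwards [LpToLpRestrictCLM_coeFn ℝ (Ioo 0 T) (Lp.compMeasurePreserving (g τ)
      (measurePreserving_sub_right volume (τ : ℝ)) U), ae_restrict_of_ae h2,
    coeFn_translation τ u, ae_restrict_mem measurableSet_Ioo] with t h3 h4 h5 h6
  rw [h5, shiftFun_of_mem τ u h6, ← h4, ← h3]
  rfl

theorem isContractionSemigroup_translationL (hr : r ≠ ∞) :
    IsContractionSemigroup (translationL F r T) where
  zero := translation_zero F r T
  add := translation_translation
  norm_le := norm_translation_le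
  continuous := continuous_translation hr

/-! ### Time reversal -/

variable (T) in
theorem measurePreserving_reversal :
    MeasurePreserving (fun t => T - t) (timeMeasure T) (timeMeasure T) := by
  have h := (Measure.measurePreserving_sub_left volume T).restrict_preimage
    (measurableSet_Ioo (a := 0) (b := T))
  simpa using h

variable (F r T) in
/-- Time reversal on `L^r(0,T; F)`. -/
def reversal : Lp F r (timeMeasure T) →L[ℝ] Lp F r (timeMeasure T) :=
  (Lp.compMeasurePreservingₗᵢ ℝ _ (measurePreserving_reversal T)).toContinuousLinearMap

theorem coeFn_reversal (u : Lp F r (timeMeasure T)) :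
    reversal F r T u =ᵐ[timeMeasure T] fun t => u (T - t) :=
  Lp.coeFn_compMeasurePreserving u (measurePreserving_reversal T)

theorem reversal_reversal (u : Lp F r (timeMeasure T)) :
    reversal F r T (reversal F r T u) = u := by
  apply Lp.ext
  filter_upwards [coeFn_reversal (reversal F r T u),
    (measurePreserving_reversal T).quasiMeasurePreserving.ae (coeFn_reversal u)] with t h1 h2
  rw [h1, h2]
  simp

end Translation

/-! ### The duality pairing -/

section Pairing

variable {p T : ℝ} {V : Type*} [NormedAddCommGroup V] [NormedSpace ℝ V]

instance holderConjugate_ofReal (p : ℝ) [hp : Fact (2 ≤ p)] :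
    ENNReal.HolderConjugate (ENNReal.ofReal (p / (p - 1))) (ENNReal.ofReal p) :=
  (Real.HolderConjugate.conjExponent (by linarith [hp.out])).symm.ennrealOfReal

variable [Fact (2 ≤ p)]

variable (p T V) in
/-- The duality pairing as a bounded bilinear map. -/
def pairingL : SpaceVDual p T V →L[ℝ] SpaceV p T V →L[ℝ] ℝ :=
  (ContinuousLinearMap.id ℝ (StrongDual ℝ V)).lpPairing (timeMeasure T)
    (ENNReal.ofReal (p / (p - 1))) (ENNReal.ofReal p)

@[simp]
theorem pairingL_apply (z : SpaceVDual p T V) (v : SpaceV p T V) :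
    pairingL p T V z v = pairing z v :=
  ContinuousLinearMap.lpPairing_eq_integral _ _ _

/-- The adjoint of the right shift is the left shift, and reversal of time turns the left shift back
into the right shift. Concretely, the two integrands agree after the substitution `t ↦ t - τ`, both
vanishing off `τ < t < T`. -/
theorem pairing_translation_reversal (τ : ℝ≥0) (y : SpaceVDual p T V) (x : SpaceV p T V) :
    pairing (translation τ y) (reversal V _ T x) = pairing y (reversal V _ T (translation τ x)) := by
  have hτ : (0 : ℝ) ≤ τ := τ.2
  have h1 : pairing (translation τ y) (reversal V _ T x)
      = ∫ t in Ioo 0 T, shiftFun (τ : ℝ) y t (x (T - t)) := by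
    refine integral_congr_ae ?_
    filter_upwards [coeFn_translation τ y, coeFn_reversal x] with t h1 h2
    rw [h1, h2]
  have h2 : pairing y (reversal V _ T (translation τ x))
      = ∫ t in Ioo 0 T, y t (shiftFun (τ : ℝ) x (T - t)) := by
    refine integral_congr_ae ?_
    filter_upwards [coeFn_reversal (translation τ x),
      (measurePreserving_reversal T).quasiMeasurePreserving.ae (coeFn_translation τ x)] with t h1 h2
    rw [h1, h2]
  rw [h1, h2, ← integral_indicator measurableSet_Ioo, ← integral_indicator measurableSet_Ioo,
    ← integral_sub_right_eq_self (fun t => (Ioo 0 T).indicator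
      (fun t => y t (shiftFun (τ : ℝ) x (T - t))) t) (τ : ℝ)]
  congr 1
  funext t
  simp only [indicator, shiftFun, mem_Ioo]
  by_cases ht : (τ : ℝ) < t ∧ t < T
  · have e1 : 0 < t ∧ t < T := ⟨by linarith, ht.2⟩
    have e2 : 0 < t - (τ : ℝ) ∧ t - (τ : ℝ) < T := ⟨by linarith, by linarith⟩
    rw [if_pos e1, if_pos e2, if_neg (by linarith), if_neg (by linarith)]
    congr 2
    ring
  · rw [not_and_or, not_lt, not_lt] at ht
    rcases ht with ht | ht
    · rw [if_neg (c := 0 < t - (τ : ℝ) ∧ _) (fun h => by linarith [h.1]), if_pos ht]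
      simp
    · rw [if_neg (c := 0 < t ∧ _) (fun h => by linarith [h.2]),
        if_pos (c := T - (t - (τ : ℝ)) ≤ τ) (by linarith)]
      simp

/-- Testing with indicators times a fixed `v` gives `z t v = 0` almost everywhere; separability
makes the exceptional null set independent of `v`. -/
theorem eq_zero_of_pairing_eq_zero [TopologicalSpace.SeparableSpace V] {z : SpaceVDual p T V}
    (hz : ∀ v, pairing z v = 0) : z = 0 := by
  have h1 : ∀ v : V, ∀ᵐ t ∂timeMeasure T, z t v = 0 := by
    intro v
    have hint : Integrable (fun t => z t v) (timeMeasure T) :=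
      (ContinuousLinearMap.apply ℝ ℝ v).integrable_comp
        ((Lp.memLp z).integrable (Fact.out : 1 ≤ ENNReal.ofReal (p / (p - 1))))
    refine hint.ae_eq_zero_of_forall_setIntegral_eq_zero fun s hs hμ => ?_
    have h2 := hz (indicatorConstLp (ENNReal.ofReal p) hs hμ.ne v)
    rw [← integral_indicator hs, ← h2]
    refine integral_congr_ae ?_
    filter_upwards [indicatorConstLp_coeFn (p := ENNReal.ofReal p) (hs := hs) (hμs := hμ.ne)
      (c := v)] with t ht
    rw [ht]
    by_cases h : t ∈ s <;> simp [h]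
  have h2 : ∀ᵐ t ∂timeMeasure T, ∀ n, z t (TopologicalSpace.denseSeq V n) = 0 :=
    ae_all_iff.2 fun n => h1 _
  apply Lp.ext
  filter_upwards [h2, Lp.coeFn_zero (StrongDual ℝ V) (ENNReal.ofReal (p / (p - 1)))
    (timeMeasure T)] with t ht h0
  rw [h0]
  refine ContinuousLinearMap.ext fun v => ?_
  have := (TopologicalSpace.denseRange_denseSeq V).equalizer (z t).continuous
    (continuous_const (y := (0 : ℝ))) (funext ht)
  exact congrFun this v

end Pairing

/-! ### The embeddings as bounded operators -/

section Embeddings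

theorem norm_inclusion_le {α F : Type*} {m : MeasurableSpace α} {μ : Measure α} [IsFiniteMeasure μ]
    [NormedAddCommGroup F] {r s : ℝ≥0∞} (hr : 1 ≤ r) (hrs : r ≤ s) (hs : s ≠ ∞) (f : Lp F s μ) :
    ‖(AddSubgroup.inclusion (Lp.antitone hrs) f : Lp F r μ)‖
      ≤ (μ univ ^ (1 / r.toReal - 1 / s.toReal)).toReal * ‖f‖ := by
  have h0 : μ univ ^ (1 / r.toReal - 1 / s.toReal) ≠ ∞ := by
    refine ENNReal.rpow_ne_top_of_nonneg (sub_nonneg.2 ?_) (measure_ne_top μ univ)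
    exact one_div_le_one_div_of_le
      (ENNReal.toReal_pos (zero_lt_one.trans_le hr).ne' (ne_top_of_le_ne_top hs hrs))
      (ENNReal.toReal_mono hs hrs)
  rw [Lp.norm_def, Lp.norm_def, mul_comm, ← ENNReal.toReal_mul]
  exact ENNReal.toReal_mono (ENNReal.mul_ne_top (Lp.eLpNorm_ne_top f) h0)
    (eLpNorm_le_eLpNorm_mul_rpow_measure_univ hrs (Lp.aestronglyMeasurable f))

/-- The inclusion `L^s ⊆ L^r`, `r ≤ s`, on a finite measure space. -/
def inclusionL {α F : Type*} {m : MeasurableSpace α} {μ : Measure α} [IsFiniteMeasure μ]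
    [NormedAddCommGroup F] [NormedSpace ℝ F] {r s : ℝ≥0∞} [Fact (1 ≤ r)] [Fact (1 ≤ s)]
    (hrs : r ≤ s) (hs : s ≠ ∞) : Lp F s μ →L[ℝ] Lp F r μ :=
  LinearMap.mkContinuous
    { toFun := AddSubgroup.inclusion (Lp.antitone hrs)
      map_add' := fun f g => map_add _ f g
      map_smul' := fun _ _ => rfl } _ fun f => norm_inclusion_le Fact.out hrs hs f

variable {p T : ℝ} [Fact (2 ≤ p)] {V H : Type*} [NormedAddCommGroup V] [NormedSpace ℝ V]
  [NormedAddCommGroup H] [InnerProductSpace ℝ H]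

variable (p T) in
/-- `embH` as a bounded operator. -/
def embHL (ι : V →L[ℝ] H) : SpaceV p T V →L[ℝ] SpaceH T H :=
  (inclusionL (two_le_ofReal p) ENNReal.ofReal_ne_top).comp (ι.compLpL _ _)

@[simp]
theorem embHL_apply (ι : V →L[ℝ] H) (v : SpaceV p T V) : embHL p T ι v = embH ι v := rfl

variable (p T) in
/-- `embDual` as a bounded operator. -/
def embDualL (ι : V →L[ℝ] H) : SpaceH T H →L[ℝ] SpaceVDual p T V :=
  (inclusionL (ofReal_conj_le_two p) ENNReal.ofNat_ne_top).comp ((hilbertToDual ι).compLpL _ _)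

@[simp]
theorem embDualL_apply (ι : V →L[ℝ] H) (h : SpaceH T H) : embDualL p T ι h = embDual ι h := rfl

theorem pairing_embDual (ι : V →L[ℝ] H) (h : SpaceH T H) (v : SpaceV p T V) :
    pairing (embDual ι h) v = ⟪h, embH ι v⟫ := by
  rw [L2.inner_def]
  refine integral_congr_ae ?_
  filter_upwards [coeFn_embDual (p := p) ι h, coeFn_embH ι v] with t h1 h2
  rw [h1, h2, hilbertToDual_apply]

theorem translation_embH (ι : V →L[ℝ] H) (τ : ℝ≥0) (v : SpaceV p T V) :
    translation τ (embH ι v) = embH ι (translation τ v) :=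
  congrArg (AddSubgroup.inclusion (Lp.antitone (two_le_ofReal p))) (translation_compLp ι τ v)

theorem translation_embDual (ι : V →L[ℝ] H) (τ : ℝ≥0) (h : SpaceH T H) :
    translation τ (embDual ι h : SpaceVDual p T V) = embDual ι (translation τ h) :=
  congrArg (AddSubgroup.inclusion (Lp.antitone (ofReal_conj_le_two p)))
    (translation_compLp (hilbertToDual ι) τ h)

end Embeddings

/-! ### Weak limits -/

section WeakLimits

theorem exists_ultrafilter_limit {α E : Type*} [NormedAddCommGroup E] [NormedSpace ℝ E]
    (U : Ultrafilter α) (φ : α → StrongDual ℝ E) {c : ℝ} (hφ : ∀ᶠ a in U, ‖φ a‖ ≤ c) :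
    ∃ Φ : StrongDual ℝ E, ‖Φ‖ ≤ c ∧ ∀ x, Tendsto (fun a => φ a x) U (𝓝 (Φ x)) := by
  obtain ⟨Φ, hΦ, hlim⟩ := (WeakDual.isCompact_closedBall (𝕜 := ℝ) (0 : StrongDual ℝ E) c
    ).ultrafilter_le_nhds (U.map fun a => StrongDual.toWeakDual (φ a)) (by
      rw [le_principal_iff]
      change ∀ᶠ a in (U : Filter α), _
      filter_upwards [hφ] with a ha
      simpa using ha)
  refine ⟨WeakDual.toStrongDual Φ, by simpa using hΦ, fun x => ?_⟩
  exact ((WeakDual.eval_continuous x).tendsto Φ).comp hlim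

/-- Balls of `V` are closed in `H`: a bounded part of the net has a weak limit point, which lies in
`V` by reflexivity and is mapped by `ι` to the strong limit `h`. -/
theorem exists_norm_le_of_frequently {α V H : Type*} [NormedAddCommGroup V] [NormedSpace ℝ V]
    [NormedAddCommGroup H] [InnerProductSpace ℝ H] (hV : IsReflexive V) (ι : V →L[ℝ] H)
    {l : Filter α} {v : α → V} {h : H} (hv : Tendsto (fun a => ι (v a)) l (𝓝 h)) {c : ℝ}
    (hc : ∃ᶠ a in l, ‖v a‖ ≤ c) : ∃ x, ι x = h ∧ ‖x‖ ≤ c := by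
  have : NeBot (l ⊓ 𝓟 {a | ‖v a‖ ≤ c}) := frequently_mem_iff_neBot.1 hc
  let U := Ultrafilter.of (l ⊓ 𝓟 {a | ‖v a‖ ≤ c})
  have hU : (U : Filter α) ≤ l ⊓ 𝓟 {a | ‖v a‖ ≤ c} := Ultrafilter.of_le _
  obtain ⟨Φ, hΦ, hlim⟩ := exists_ultrafilter_limit U
    (fun a => NormedSpace.inclusionInDoubleDual ℝ V (v a)) (c := c) (by
      filter_upwards [le_principal_iff.1 (hU.trans inf_le_right)] with a ha
      exact (NormedSpace.double_dual_bound ℝ V _).trans ha)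
  obtain ⟨x, rfl⟩ := hV Φ
  refine ⟨x, ext_inner_left ℝ fun k => ?_, ?_⟩
  · have h1 := hlim ((innerSL ℝ k).comp ι)
    have h2 : Tendsto (fun a => ⟪k, ι (v a)⟫) U (𝓝 ⟪k, h⟫) :=
      (tendsto_const_nhds.inner hv).mono_left (hU.trans inf_le_left)
    exact tendsto_nhds_unique h1 h2
  · have h1 := (NormedSpace.inclusionInDoubleDualLi ℝ (E := V)).norm_map x
    exact h1.symm.le.trans hΦ

theorem lintegral_enorm_rpow_le {p T : ℝ} (hp0 : 0 < p) {V : Type*} [NormedAddCommGroup V]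
    {v : SpaceV p T V} {R : ℝ} (hv : ‖v‖ ≤ R) :
    ∫⁻ t, ‖v t‖ₑ ^ p ∂timeMeasure T ≤ ENNReal.ofReal R ^ p := by
  have h1 : eLpNorm v (ENNReal.ofReal p) (timeMeasure T) ≤ ENNReal.ofReal R := by
    rw [← ENNReal.ofReal_toReal (Lp.eLpNorm_ne_top v), ← Lp.norm_def]
    exact ENNReal.ofReal_le_ofReal hv
  rw [eLpNorm_eq_lintegral_rpow_enorm_toReal (by simpa using hp0) ENNReal.ofReal_ne_top,
    ENNReal.toReal_ofReal hp0.le, one_div] at h1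
  exact (ENNReal.rpow_inv_le_iff hp0).1 h1

variable {p T : ℝ} [hp : Fact (2 ≤ p)] {V H : Type*} [NormedAddCommGroup V] [NormedSpace ℝ V]
  [NormedAddCommGroup H] [InnerProductSpace ℝ H]

/-- Along an almost everywhere convergent subsequence, reflexivity of `V` provides pointwise
preimages of the limit, and Fatou's lemma bounds their `L^p` norm. -/
theorem isClosed_image_closedBall [CompleteSpace V]
    [TopologicalSpace.SeparableSpace V] (hV : IsReflexive V) {ι : V →L[ℝ] H}
    (hι : IsDenseEmbedding ι) (R : ℝ) :
    IsClosed ((embH ι : SpaceV p T V → SpaceH T H) '' Metric.closedBall 0 R) := by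
  have hp0 : 0 < p := by linarith [hp.out]
  refine IsSeqClosed.isClosed fun w h hw hlim => ?_
  choose u hu huw using hw
  obtain ⟨ns, -, hns⟩ := (tendstoInMeasure_of_tendsto_Lp hlim).exists_seq_tendsto_ae
  let g : ℝ → ℝ≥0∞ := fun t => liminf (fun k => ‖u (ns k) t‖ₑ ^ p) atTop
  have hmeas : ∀ k, Measurable fun t => ‖u (ns k) t‖ₑ ^ p := fun k =>
    (Lp.stronglyMeasurable (u (ns k))).enorm.pow_const p
  have hgm : Measurable g := Measurable.liminf hmeas
  have hg : ∫⁻ t, g t ∂timeMeasure T ≤ ENNReal.ofReal R ^ p := by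
    refine (lintegral_liminf_le hmeas).trans ?_
    refine (liminf_le_liminf (v := fun _ => ENNReal.ofReal R ^ p)
      (Eventually.of_forall fun k => ?_)).trans (liminf_const _).le
    exact lintegral_enorm_rpow_le hp0 (by simpa using hu (ns k))
  have hfin : ∀ᵐ t ∂timeMeasure T, g t < ∞ :=
    ae_lt_top hgm (ne_top_of_le_ne_top (ENNReal.rpow_ne_top_of_nonneg hp0.le
      ENNReal.ofReal_ne_top) hg)
  have hpt : ∀ᵐ t ∂timeMeasure T, ∃ x, ι x = h t ∧ ‖x‖ₑ ^ p ≤ g t := by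
    have hcoe : ∀ᵐ t ∂timeMeasure T, ∀ k, w (ns k) t = ι (u (ns k) t) :=
      ae_all_iff.2 fun k => by
        rw [← huw]
        exact coeFn_embH ι (u (ns k))
    filter_upwards [hns, hfin, hcoe] with t h1 h2 h3
    simp only [h3] at h1
    -- Only levels strictly above the liminf are attained frequently. Injectivity of `ι` makes the
    -- preimages for all levels coincide, so the bound passes down to `g t`.
    have key : ∀ c, g t < c → c < ∞ → ∃ x, ι x = h t ∧ ‖x‖ₑ ^ p ≤ c := by
      intro c hc hc'
      have hfreq : ∃ᶠ k in atTop, ‖u (ns k) t‖ ≤ (c ^ p⁻¹).toReal := by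
        refine (frequently_lt_of_liminf_lt (by isBoundedDefault) hc).mono fun k hk => ?_
        rw [← toReal_enorm]
        refine ENNReal.toReal_mono (ENNReal.rpow_ne_top_of_nonneg (inv_nonneg.2 hp0.le) hc'.ne) ?_
        exact (ENNReal.le_rpow_inv_iff hp0).2 hk.le
      obtain ⟨x, hx, hxc⟩ := exists_norm_le_of_frequently hV ι h1 hfreq
      refine ⟨x, hx, (ENNReal.le_rpow_inv_iff hp0).1 ?_⟩
      rw [← ofReal_norm, ← ENNReal.ofReal_toReal
        (ENNReal.rpow_ne_top_of_nonneg (inv_nonneg.2 hp0.le) hc'.ne)]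
      exact ENNReal.ofReal_le_ofReal hxc
    obtain ⟨c, hc, hc'⟩ := exists_between h2
    obtain ⟨x, hx, -⟩ := key c hc hc'
    refine ⟨x, hx, le_of_forall_gt_imp_ge_of_dense fun d hd => ?_⟩
    rcases eq_or_ne d ∞ with rfl | hd'
    · exact le_top
    · obtain ⟨y, hy, hyd⟩ := key d hd hd'.lt_top
      rwa [hι.1 (hx.trans hy.symm)]
  borelize V
  borelize H
  have : SecondCountableTopology V := UniformSpace.secondCountable_of_separable V
  have : TopologicalSpace.SeparableSpace H := hι.2.separableSpace ι.continuous
  have : SecondCountableTopology H := UniformSpace.secondCountable_of_separable H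
  -- A continuous injection between these Polish spaces is a measurable embedding (Lusin–Souslin),
  -- so its inverse extends to a measurable map; this makes the pointwise preimage measurable in
  -- `t`.
  obtain ⟨G, hG, hGι⟩ := (ι.continuous.measurableEmbedding hι.1).exists_measurable_extend
    (measurable_id (α := V)) fun _ => inferInstance
  have hae : ∀ᵐ t ∂timeMeasure T, ι (G (h t)) = h t ∧ ‖G (h t)‖ₑ ^ p ≤ g t := by
    filter_upwards [hpt] with t ⟨x, hx, hxg⟩
    have : G (h t) = x := by rw [← hx]; exact congrFun hGι x
    rw [this]
    exact ⟨hx, hxg⟩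
  have hvm : AEStronglyMeasurable (fun t => G (h t)) (timeMeasure T) :=
    (hG.comp (Lp.stronglyMeasurable h).measurable).aestronglyMeasurable
  have hnorm : eLpNorm (fun t => G (h t)) (ENNReal.ofReal p) (timeMeasure T)
      ≤ ENNReal.ofReal R := by
    rw [eLpNorm_eq_lintegral_rpow_enorm_toReal (by simpa using hp0) ENNReal.ofReal_ne_top,
      ENNReal.toReal_ofReal hp0.le, one_div, ENNReal.rpow_inv_le_iff hp0]
    exact (lintegral_mono_ae (hae.mono fun t ht => ht.2)).trans hg
  have hmem : MemLp (fun t => G (h t)) (ENNReal.ofReal p) (timeMeasure T) :=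
    ⟨hvm, hnorm.trans_lt ENNReal.ofReal_lt_top⟩
  have hR : 0 ≤ R := (norm_nonneg _).trans (by simpa using hu 0)
  refine ⟨hmem.toLp _, ?_, ?_⟩
  · rw [mem_closedBall_zero_iff, Lp.norm_toLp]
    exact ENNReal.toReal_le_of_le_ofReal hR hnorm
  · apply Lp.ext
    filter_upwards [coeFn_embH ι (hmem.toLp _), hmem.coeFn_toLp, hae] with t h1 h2 h3
    rw [h1, h2, h3.1]

/-- By reflexivity a separating functional is evaluation at some `v`; being bounded above on a
linear subspace it vanishes there, so `ι v = 0` and `v = 0`. -/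
theorem denseRange_hilbertToDual (hV : IsReflexive V) {ι : V →L[ℝ] H} (hι : IsDenseEmbedding ι) :
    DenseRange (hilbertToDual ι) := by
  intro φ
  by_contra hφ
  have hconv : Convex ℝ (closure (range (hilbertToDual ι))) := by
    rw [← image_univ]
    exact (convex_univ.is_linear_image (hilbertToDual ι).isLinear).closure
  obtain ⟨Φ, c, h1, h2⟩ := geometric_hahn_banach_closed_point hconv isClosed_closure hφ
  obtain ⟨v, rfl⟩ := hV Φ
  have h3 : ∀ k, ⟪k, ι v⟫ < c := fun k => h1 _ (subset_closure ⟨k, rfl⟩)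
  have hc : 0 < c := by simpa using h3 0
  by_cases hv : ι v = 0
  · have : v = 0 := hι.1 (by rw [hv, map_zero])
    subst this
    simp only [map_zero, zero_apply] at h2
    linarith
  · have h4 := h3 ((c / ⟪ι v, ι v⟫) • ι v)
    rw [real_inner_smul_left, div_mul_cancel₀ _ (by simpa using hv)] at h4
    exact lt_irrefl _ h4

theorem denseRange_embDual (hV : IsReflexive V) {ι : V →L[ℝ] H} (hι : IsDenseEmbedding ι) :
    DenseRange (embDual ι : SpaceH T H → SpaceVDual p T V) := by
  intro z
  refine Lp.induction (p := ENNReal.ofReal (p / (p - 1))) ENNReal.ofReal_ne_top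
    (fun z => z ∈ closure (range (embDual ι : SpaceH T H → SpaceVDual p T V)))
    (fun c s hs hμ => ?_) (fun f g hf hg _ h1 h2 => ?_) isClosed_closure z
  · rw [Lp.simpleFunc.coe_indicatorConst]
    have h1 : Continuous fun c : StrongDual ℝ V =>
        indicatorConstLp (ENNReal.ofReal (p / (p - 1))) hs hμ.ne c := by
      refine (LipschitzWith.of_dist_le' (K := (timeMeasure T).real s ^
        (1 / (ENNReal.ofReal (p / (p - 1))).toReal)) fun c d => ?_).continuous
      rw [dist_eq_norm, dist_eq_norm, indicatorConstLp_sub, mul_comm]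
      exact norm_indicatorConstLp_le
    have h2 := h1.range_subset_closure_image_dense (denseRange_hilbertToDual hV hι)
    refine closure_mono ?_ (h2 ⟨c, rfl⟩)
    rintro _ ⟨_, ⟨k, rfl⟩, rfl⟩
    refine ⟨indicatorConstLp 2 hs hμ.ne k, ?_⟩
    apply Lp.ext
    filter_upwards [coeFn_embDual (p := p) ι (indicatorConstLp 2 hs hμ.ne k),
      indicatorConstLp_coeFn (p := 2) (hs := hs) (hμs := hμ.ne) (c := k),
      indicatorConstLp_coeFn (p := ENNReal.ofReal (p / (p - 1))) (hs := hs) (hμs := hμ.ne)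
        (c := hilbertToDual ι k)] with t h3 h4 h5
    rw [h3, h4, h5]
    by_cases h : t ∈ s <;> simp [h]
  · have : range (embDual ι : SpaceH T H → SpaceVDual p T V)
        = (LinearMap.range (embDualL p T ι).toLinearMap : Set (SpaceVDual p T V)) := by
      ext; simp
    rw [this, ← Submodule.topologicalClosure_coe] at h1 h2 ⊢
    exact Submodule.add_mem _ h1 h2

/-- No description of the dual of `L^p(0,T; V)` is needed. A bounded net has a weak limit in `𝓗`;
the image of the ball is convex and closed, so the limit stays in it; density of `𝓗` in `𝒱*` and the
uniform bound extend convergence to every `y`. -/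
theorem hasWeakLimits_pairingL [CompleteSpace V] [CompleteSpace H]
    [TopologicalSpace.SeparableSpace V] (hV : IsReflexive V) {ι : V →L[ℝ] H}
    (hι : IsDenseEmbedding ι) : HasWeakLimits (pairingL p T V) := by
  intro R U g hg
  obtain ⟨Φ, -, hΦ⟩ := exists_ultrafilter_limit U (fun i => innerSL ℝ (embH ι (g i) : SpaceH T H))
    (c := ‖embHL p T ι‖ * R) (Eventually.of_forall fun i => by
      rw [innerSL_apply_norm]
      refine ((embHL p T ι).le_opNorm _).trans ?_
      gcongr
      exact hg i)
  obtain ⟨h, rfl⟩ := (InnerProductSpace.toDual ℝ (SpaceH T H)).surjective Φ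
  simp only [InnerProductSpace.toDual_apply_apply, innerSL_apply_apply] at hΦ
  have hmem : h ∈ (embH ι : SpaceV p T V → SpaceH T H) '' Metric.closedBall 0 R := by
    by_contra hcon
    obtain ⟨Ψ, c, h1, h2⟩ := geometric_hahn_banach_closed_point
      ((convex_closedBall 0 R).is_linear_image (embHL p T ι).isLinear)
      (isClosed_image_closedBall hV hι R) hcon
    obtain ⟨k, rfl⟩ := (InnerProductSpace.toDual ℝ (SpaceH T H)).surjective Ψ
    simp only [InnerProductSpace.toDual_apply_apply] at h1 h2
    have h3 : ⟪h, k⟫ ≤ c := le_of_tendsto (hΦ k) (Eventually.of_forall fun i => by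
      rw [real_inner_comm]
      exact (h1 _ ⟨g i, by simpa using hg i, rfl⟩).le)
    rw [real_inner_comm] at h3
    linarith
  obtain ⟨u, hu, rfl⟩ := hmem
  have huR : ‖u‖ ≤ R := by simpa using hu
  refine ⟨u, huR, fun y => ?_⟩
  have hR : 0 ≤ R := (norm_nonneg u).trans huR
  rw [Metric.tendsto_nhds]
  intro ε hε
  obtain ⟨k, hk⟩ : ∃ k : SpaceH T H, dist y (embDual ι k) < ε / (3 * (‖pairingL p T V‖ * R + 1)) :=
    (denseRange_embDual hV hι).exists_dist_lt y (by positivity)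
  rw [dist_eq_norm] at hk
  have h1 : ∀ x : SpaceV p T V, ‖x‖ ≤ R → |pairing (y - embDual ι k) x| ≤ ε / 3 := by
    intro x hx
    rw [← pairingL_apply, ← Real.norm_eq_abs]
    refine ((pairingL p T V).le_opNorm₂ _ _).trans ?_
    have h2 : ‖pairingL p T V‖ * ‖y - embDual ι k‖ * ‖x‖
        ≤ ‖y - embDual ι k‖ * (‖pairingL p T V‖ * R + 1) := by
      have : ‖pairingL p T V‖ * ‖x‖ ≤ ‖pairingL p T V‖ * R := by gcongr
      nlinarith [norm_nonneg (y - embDual ι k : SpaceVDual p T V)]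
    refine h2.trans ?_
    have h3 : 0 < ‖pairingL p T V‖ * R + 1 := by positivity
    calc _ ≤ ε / (3 * (‖pairingL p T V‖ * R + 1)) * (‖pairingL p T V‖ * R + 1) := by gcongr
      _ = ε / 3 := by field_simp
  have h2 := (Metric.tendsto_nhds.1 (hΦ k)) (ε / 3) (by positivity)
  filter_upwards [h2] with i hi
  have h3 := h1 _ (hg i)
  have h4 := h1 _ huR
  rw [← pairingL_apply, map_sub, sub_apply, pairingL_apply, pairingL_apply, pairing_embDual,
    real_inner_comm] at h3 h4
  rw [Real.dist_eq] at hi ⊢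
  simp only [pairingL_apply]
  rw [abs_lt] at hi ⊢
  rw [abs_le] at h3 h4
  constructor <;> linarith [h3.1, h3.2, h4.1, h4.2, hi.1, hi.2]

end WeakLimits

/-! ### Pointwise operators on `L²(0,T; H)` -/

section Pointwise

variable {T : ℝ} {H H' : Type*} [NormedAddCommGroup H] [InnerProductSpace ℝ H]
  [NormedAddCommGroup H'] [InnerProductSpace ℝ H']

theorem inner_compLp_left {L : H →L[ℝ] H'} {L' : H' →L[ℝ] H} (hL : ∀ x y, ⟪L x, y⟫ = ⟪x, L' y⟫)
    (u : SpaceH T H) (v : SpaceH T H') : ⟪L.compLp u, v⟫ = ⟪u, L'.compLp v⟫ := by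
  rw [L2.inner_def, L2.inner_def]
  refine integral_congr_ae ?_
  filter_upwards [L.coeFn_compLp u, L'.coeFn_compLp v] with t h1 h2
  rw [h1, h2, hL]

theorem compLp_leftInverse {L : H →L[ℝ] H'} {L' : H' →L[ℝ] H} (hL : ∀ y, L (L' y) = y)
    (u : SpaceH T H') : L.compLp (L'.compLp u) = u := by
  apply Lp.ext
  filter_upwards [L.coeFn_compLp (L'.compLp u), L'.coeFn_compLp u] with t h1 h2
  rw [h1, h2, hL]

variable {M : H →L[ℝ] H}

theorem inner_compLp_self_eq (u : SpaceH T H) :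
    ⟪M.compLp u, u⟫ = ∫ t in Ioo 0 T, ⟪M (u t), u t⟫ := by
  rw [L2.inner_def]
  refine integral_congr_ae ?_
  filter_upwards [M.coeFn_compLp u] with t h1
  rw [h1]

theorem integrable_inner_apply_self (u : SpaceH T H) :
    Integrable (fun t => ⟪M (u t), u t⟫) (timeMeasure T) := by
  refine (L2.integrable_inner (𝕜 := ℝ) (M.compLp u) u).congr ?_
  filter_upwards [M.coeFn_compLp u] with t h1
  rw [h1]

theorem inner_compLp_self_nonneg (hM : ∀ x, 0 ≤ ⟪M x, x⟫) (u : SpaceH T H) :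
    0 ≤ ⟪M.compLp u, u⟫ := by
  rw [inner_compLp_self_eq]
  exact integral_nonneg fun t => hM _

/-- The shift only pushes part of the nonnegative density `⟪M u, u⟫` beyond time `T`. -/
theorem inner_compLp_translation_le (hM : ∀ x, 0 ≤ ⟪M x, x⟫) (τ : ℝ≥0) (u : SpaceH T H) :
    ⟪M.compLp (translation τ u), translation τ u⟫ ≤ ⟪M.compLp u, u⟫ := by
  rw [inner_compLp_self_eq, inner_compLp_self_eq]
  set φ : ℝ → ℝ := (Ioo 0 T).indicator fun t => ⟪M (u t), u t⟫ with hφ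
  have hφi : Integrable φ := (integrable_indicator_iff measurableSet_Ioo).2
    (integrable_inner_apply_self u)
  have hφ0 : ∀ t, 0 ≤ φ t := fun t => indicator_nonneg (fun _ _ => hM _) t
  calc ∫ t in Ioo 0 T, ⟪M (translation τ u t), translation τ u t⟫
      = ∫ t in Ioo 0 T, φ (t - τ) := by
        refine integral_congr_ae ?_
        filter_upwards [coeFn_translation τ u, ae_restrict_mem measurableSet_Ioo] with t h1 h2
        rw [h1, shiftFun_of_mem τ u h2, hφ]
        by_cases h : t - (τ : ℝ) ∈ Ioo 0 T <;> simp [h]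
    _ ≤ ∫ t, φ (t - τ) := setIntegral_le_integral (hφi.comp_sub_right (τ : ℝ))
        (Eventually.of_forall fun t => hφ0 _)
    _ = ∫ t, φ t := integral_sub_right_eq_self φ (τ : ℝ)
    _ = _ := integral_indicator measurableSet_Ioo

/-- With `z = S(τ) u` and `M` symmetric, `2 (M u - M z, u) = (M (u - z), u - z) + (M u, u) - (M z,
z)`. -/
theorem inner_sub_translation_nonneg (hM : ∀ x, 0 ≤ ⟪M x, x⟫)
    (hsymm : ∀ x y, ⟪M x, y⟫ = ⟪M y, x⟫) (τ : ℝ≥0) (u : SpaceH T H) :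
    0 ≤ ⟪M.compLp u - M.compLp (translation τ u), u⟫ := by
  have h1 := inner_compLp_self_nonneg hM (u - translation τ u)
  have h2 := inner_compLp_translation_le hM τ u
  have h3 : ⟪M.compLp u, translation τ u⟫ = ⟪M.compLp (translation τ u), u⟫ := by
    rw [inner_compLp_left (L' := M) fun x y => by rw [hsymm, real_inner_comm], real_inner_comm]
  have h4 : M.compLp (u - translation τ u) = M.compLp u - M.compLp (translation τ u) :=
    map_sub (M.compLpL 2 (timeMeasure T)) u (translation τ u)
  rw [h4, inner_sub_left, inner_sub_right, inner_sub_right] at h1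
  rw [inner_sub_left]
  linarith

end Pointwise

/-! ### Accretive operators -/

theorem IsAccretive.eq_of_smul_add_eq {E : Type*} [NormedAddCommGroup E] [InnerProductSpace ℝ E]
    {D : Set E} {G : D → E} (hG : IsAccretive D G) {s : ℝ} (hs : 0 < s) {u v : D}
    (h : s • (u : E) + G u = s • (v : E) + G v) : u = v := by
  have h1 : G u - G v = -(s • ((u : E) - v)) := by
    rw [smul_sub, neg_sub, sub_eq_sub_iff_add_eq_add, add_comm, h]
  have h2 := hG u v
  rw [h1, inner_neg_left, real_inner_smul_left, real_inner_self_eq_norm_sq] at h2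
  have h3 : ‖(u : E) - v‖ ^ 2 ≤ 0 := by
    by_contra! hpos
    have := mul_pos hs hpos
    linarith
  have h4 : ‖(u : E) - v‖ = 0 := by
    have := sq_nonneg ‖(u : E) - v‖
    exact pow_eq_zero_iff two_ne_zero |>.1 (le_antisymm h3 this)
  exact Subtype.ext (sub_eq_zero.1 (norm_eq_zero.1 h4))

/-! ### The restricted evolution operator is maximal accretive -/

theorem pairing_sub_left {p T : ℝ} [Fact (2 ≤ p)] {V : Type*} [NormedAddCommGroup V]
    [NormedSpace ℝ V] (y z : SpaceVDual p T V) (v : SpaceV p T V) :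
    pairing (y - z) v = pairing y v - pairing z v := by
  rw [← pairingL_apply, map_sub]
  simp

namespace ProblemSet

variable {p T : ℝ} [Fact (2 ≤ p)] {V H : Type*} [NormedAddCommGroup V] [NormedSpace ℝ V]
  [NormedAddCommGroup H] [InnerProductSpace ℝ H]

/-- The operator `u ↦ ℳ u` from `𝒱` to `𝒱*`. -/
def degenerateOp (P : ProblemSet p T V H) : SpaceV p T V →L[ℝ] SpaceVDual p T V :=
  (embDualL p T P.ι).comp ((P.M.compLpL 2 (timeMeasure T)).comp (embHL p T P.ι))

theorem degenerateOp_apply (P : ProblemSet p T V H) (u : SpaceV p T V) :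
    P.degenerateOp u = embDual P.ι (P.M.compLp (embH P.ι u)) := rfl

theorem translation_degenerateOp (P : ProblemSet p T V H) (τ : ℝ≥0) (u : SpaceV p T V) :
    P.degenerateOp (translation τ u) = translation τ (P.degenerateOp u) := by
  rw [degenerateOp_apply, degenerateOp_apply, translation_embDual, translation_compLp,
    translation_embH]

variable {P : ProblemSet p T V H}

theorem IsProper.isDegenerateSetting (hP : P.IsProper) :
    IsDegenerateSetting (pairingL p T V) (translationL V (ENNReal.ofReal p) T)
      (translationL (StrongDual ℝ V) (ENNReal.ofReal (p / (p - 1))) T) P.degenerateOp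
      (reversal V (ENNReal.ofReal p) T) := by
  have := hP.banach
  have := hP.hilbert
  have := hP.separable
  refine
  { semigroup := isContractionSemigroup_translationL ENNReal.ofReal_ne_top
    semigroup' := isContractionSemigroup_translationL ENNReal.ofReal_ne_top
    surjective_reversal := fun x => ⟨_, reversal_reversal x⟩
    adjoint := fun τ y x => by simpa using pairing_translation_reversal τ y x
    commute := fun τ x => P.translation_degenerateOp τ x
    nonneg := fun x => ?_
    nonneg_sub := fun τ x => ?_
    nondegenerate := fun y hy => eq_zero_of_pairing_eq_zero fun v => by simpa using hy v
    weakLimits := hasWeakLimits_pairingL hP.reflexive hP.denseEmbedding }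
  · rw [pairingL_apply, degenerateOp_apply, pairing_embDual]
    exact inner_compLp_self_nonneg hP.monotone_M _
  · rw [translationL_apply, ← translation_degenerateOp, map_sub, sub_apply, pairingL_apply,
      pairingL_apply, degenerateOp_apply, degenerateOp_apply, pairing_embDual, pairing_embDual,
      ← inner_sub_left, ← translation_embH]
    exact inner_sub_translation_nonneg hP.monotone_M hP.symmetric_M _ _

theorem isAccretive_restrictedOp (hP : P.IsProper) (f : SpaceVDual p T V) :
    IsAccretive (P.domain f) (P.restrictedOp f) := by
  intro u v
  obtain ⟨w, hw, hw'⟩ := u.2.choose_spec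
  obtain ⟨z, hz, hz'⟩ := v.2.choose_spec
  change P.cauchyOp f w = embDual P.ι (P.restrictedOp f u) at hw'
  change P.cauchyOp f z = embDual P.ι (P.restrictedOp f v) at hz'
  have h1 : (u : SpaceH T H) - (v : SpaceH T H) = embH P.ι ((w : SpaceV p T V) - (z : SpaceV p T V)) := by
    rw [← hw, ← hz]
    exact (map_sub (embHL p T P.ι) (w : SpaceV p T V) (z : SpaceV p T V)).symm
  have h2 : (embDual P.ι (P.restrictedOp f u - P.restrictedOp f v) : SpaceVDual p T V)
      = P.cauchyOp f w - P.cauchyOp f z := by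
    rw [hw', hz']
    exact map_sub (embDualL p T P.ι) _ _
  rw [h1, ← pairing_embDual, h2]
  have h3 := HasNegGenerator.sub (S' := translationL (StrongDual ℝ V) _ T)
    ((hasTimeDeriv_iff ⟨_, w.2⟩ _).2 rfl) ((hasTimeDeriv_iff ⟨_, z.2⟩ _).2 rfl)
  have h4 := hP.isDegenerateSetting.negGenerator_nonneg
    (v := (w : SpaceV p T V) - (z : SpaceV p T V)) (by rw [map_sub]; exact h3)
  obtain ⟨k, hk⟩ := hP.kMonotone_A
  have h5 := (k ((w : SpaceV p T V) - (z : SpaceV p T V))).2.trans (hk w z)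
  rw [← pairingL_apply] at h5 ⊢
  have h6 : P.cauchyOp f w - P.cauchyOp f z
      = (timeDeriv ⟨_, w.2⟩ - timeDeriv ⟨_, z.2⟩) + (P.A w - P.A z) := by
    simp only [cauchyOp]
    abel
  rw [h6, map_add, add_apply]
  exact add_nonneg h4 h5

/-- The operator `u ↦ s u + 𝒜 u + f - g` from `𝒱` to `𝒱*`. -/
def perturbedOp (P : ProblemSet p T V H) (f : SpaceVDual p T V) (s : ℝ) (g : SpaceH T H)
    (u : SpaceV p T V) : SpaceVDual p T V :=
  s • embDualL p T P.ι (embHL p T P.ι u) + P.A u + f - embDualL p T P.ι g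

theorem pairing_perturbedOp (f : SpaceVDual p T V) (s : ℝ) (g : SpaceH T H) (u v : SpaceV p T V) :
    pairingL p T V (P.perturbedOp f s g u) v
      = s * ⟪embH P.ι u, embH P.ι v⟫ + pairing (P.A u) v + pairing f v - ⟪g, embH P.ι v⟫ := by
  simp only [perturbedOp, map_add, map_sub, map_smul, add_apply, sub_apply, smul_apply, smul_eq_mul,
    pairingL_apply, embDualL_apply, embHL_apply, pairing_embDual]

theorem isMonotoneOp_perturbedOp (hP : P.IsProper) (f : SpaceVDual p T V) {s : ℝ} (hs : 0 < s)
    (g : SpaceH T H) : IsMonotoneOp (pairingL p T V) (P.perturbedOp f s g) where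
  mono u v := by
    obtain ⟨k, hk⟩ := hP.kMonotone_A
    have h1 := (k (u - v)).2.trans (hk u v)
    rw [pairing_sub_left] at h1
    have h2 : 0 ≤ s * (⟪embH P.ι u, embH P.ι (u - v)⟫ - ⟪embH P.ι v, embH P.ι (u - v)⟫) := by
      have h3 : embH P.ι (u - v) = embH P.ι u - embH P.ι v := map_sub (embHL p T P.ι) u v
      rw [← inner_sub_left, ← h3]
      exact mul_nonneg hs.le real_inner_self_nonneg
    rw [pairingL_apply, pairing_sub_left, ← pairingL_apply, ← pairingL_apply, pairing_perturbedOp,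
      pairing_perturbedOp]
    linarith
  hemi u v w := by
    simp only [pairing_perturbedOp]
    refine ContinuousOn.sub (ContinuousOn.add (ContinuousOn.add ?_ (hP.hemicontinuous_A u v w))
      continuousOn_const) continuousOn_const
    refine Continuous.continuousOn (continuous_const.mul (Continuous.inner ?_ continuous_const))
    exact (embHL p T P.ι).continuous.comp
      (continuous_const.add (continuous_id.smul continuous_const))
  bdd R := by
    obtain ⟨C, hC⟩ := (hP.bounded_A _ (Metric.isBounded_closedBall (x := 0) (r := R))).exists_norm_le
    refine ⟨‖s • (embDualL p T P.ι).comp (embHL p T P.ι)‖ * R + C + ‖f‖ + ‖embDualL p T P.ι g‖,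
      fun u hu => ?_⟩
    refine (norm_sub_le _ _).trans (add_le_add_left ((norm_add_le _ _).trans
      (add_le_add_left ((norm_add_le _ _).trans (add_le_add ?_
        (hC _ ⟨u, by simpa using hu, rfl⟩))) _)) _)
    refine ((s • (embDualL p T P.ι).comp (embHL p T P.ι)).le_opNorm u).trans ?_
    gcongr

/-- Coercivity and monotonicity imply linear growth. -/
theorem exists_linear_growth (hP : P.IsProper) :
    ∃ c R : ℝ, 0 < c ∧ 0 < R ∧ ∀ u, R ≤ ‖u‖ → c * ‖u‖ ≤ pairing (P.A u) u := by
  have h1 := (hP.coercive_A.eventually (eventually_ge_atTop 1))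
  obtain ⟨R, hR, h2⟩ : ∃ R : ℝ, 0 < R ∧ ∀ u : SpaceV p T V, R ≤ ‖u‖ → 1 ≤ pairing (P.A u) u := by
    rw [← comap_norm_atTop, eventually_comap] at h1
    obtain ⟨R, hR⟩ := eventually_atTop.1 h1
    exact ⟨max R 1, by positivity, fun u hu => hR _ ((le_max_left _ _).trans hu) u rfl⟩
  refine ⟨R⁻¹, R, by positivity, hR, fun u hu => ?_⟩
  have hu0 : 0 < ‖u‖ := hR.trans_le hu
  set m := ‖u‖ / R with hm
  have hm1 : 1 ≤ m := (one_le_div hR).2 hu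
  -- The point of the ray through `u` on the sphere of radius `R`. Monotonicity between `u` and `e`
  -- gives `⟨𝒜 u, e⟩ ≥ ⟨𝒜 e, e⟩ ≥ 1` when `m > 1`, and multiplication by `m = R⁻¹ ‖u‖` gives the
  -- growth.
  set e := m⁻¹ • u with he
  have hue : u = m • e := by rw [he, smul_smul, mul_inv_cancel₀ (by positivity), one_smul]
  have hnorm : ‖e‖ = R := by
    rw [he, norm_smul, norm_inv, Real.norm_of_nonneg (by positivity), hm]
    field_simp
  have h3 := h2 e hnorm.ge
  obtain ⟨k, hk⟩ := hP.kMonotone_A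
  have h4 := (k (u - e)).2.trans (hk u e)
  have h5 : u - e = (m - 1) • e := by rw [sub_smul, one_smul, ← hue]
  rw [h5, ← pairingL_apply, map_smul, smul_eq_mul, pairingL_apply, pairing_sub_left] at h4
  have h6 : pairing (P.A u) u = m * pairing (P.A u) e := by
    rw [← pairingL_apply, ← pairingL_apply]
    conv_lhs => rw [hue, map_smul, smul_eq_mul, ← hue]
  rcases hm1.eq_or_lt with hm2 | hm2
  · have hu' : u = e := by rw [hue, ← hm2, one_smul]
    rw [hu', hnorm, inv_mul_cancel₀ hR.ne']
    exact h3
  · have h7 : 0 ≤ pairing (P.A u) e - pairing (P.A e) e :=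
      nonneg_of_mul_nonneg_right h4 (sub_pos.2 hm2)
    rw [h6, inv_mul_eq_div, ← hm]
    nlinarith

/-- Linear growth with constant `c` need not dominate `⟨f, u⟩`. Hence `f` is split into a part of
size at most `c/2 ‖u‖` in the pairing and some `k ∈ 𝓗`; the pairing with `k - g` is absorbed by `s
‖u‖²` in `𝓗`. -/
theorem exists_perturbedOp_pos (hP : P.IsProper) (f : SpaceVDual p T V) {s : ℝ} (hs : 0 < s)
    (g : SpaceH T H) :
    ∃ R : ℝ, 0 ≤ R ∧ ∀ u, R ≤ ‖u‖ → 0 < pairingL p T V (P.perturbedOp f s g u) u := by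
  obtain ⟨c, R, hc, hR, hA⟩ := exists_linear_growth hP
  obtain ⟨k, hk⟩ : ∃ k : SpaceH T H, dist f (embDual P.ι k) < c / (2 * (‖pairingL p T V‖ + 1)) :=
    (denseRange_embDual hP.reflexive hP.denseEmbedding).exists_dist_lt f (by positivity)
  rw [dist_eq_norm] at hk
  -- The constant in Young's inequality `‖k - g‖ r ≤ s r² + ‖k - g‖² / (4 s)`.
  set a := ‖k - g‖ ^ 2 / (4 * s) with ha
  have ha0 : 0 ≤ a := by positivity
  refine ⟨max R (2 * a / c + 1), hR.le.trans (le_max_left _ _), fun u hu => ?_⟩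
  have h1 := hA u ((le_max_left _ _).trans hu)
  have h2 : 2 * a / c < ‖u‖ := by linarith [(le_max_right _ _).trans hu]
  rw [div_lt_iff₀ hc] at h2
  have h3 : |pairing (f - embDual P.ι k) u| ≤ c / 2 * ‖u‖ := by
    rw [← pairingL_apply, ← Real.norm_eq_abs]
    refine ((pairingL p T V).le_opNorm₂ _ _).trans ?_
    gcongr
    have hb : 0 < ‖pairingL p T V‖ + 1 := by positivity
    calc ‖pairingL p T V‖ * ‖f - embDual P.ι k‖
        ≤ (‖pairingL p T V‖ + 1) * (c / (2 * (‖pairingL p T V‖ + 1))) := by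
          gcongr
          linarith
      _ = c / 2 := by field_simp
  rw [← pairingL_apply, map_sub, sub_apply, pairingL_apply, pairingL_apply, pairing_embDual,
    abs_le] at h3
  have h4 : -(‖k - g‖ * ‖embH P.ι u‖) ≤ ⟪k - g, embH P.ι u⟫ :=
    (abs_le.1 (abs_real_inner_le_norm _ _)).1
  rw [inner_sub_left] at h4
  have h5 : ‖k - g‖ * ‖embH P.ι u‖ ≤ s * ‖embH P.ι u‖ ^ 2 + a := by
    have h6 : a = s * (‖k - g‖ / (2 * s)) ^ 2 := by rw [ha]; field_simp; norm_num
    have h7 : ‖k - g‖ = 2 * s * (‖k - g‖ / (2 * s)) := by field_simp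
    rw [h6]
    nth_rewrite 1 [h7]
    nlinarith [mul_nonneg hs.le (sq_nonneg (‖embH P.ι u‖ - ‖k - g‖ / (2 * s)))]
  rw [pairing_perturbedOp, real_inner_self_eq_norm_sq]
  linarith [h3.1]

/-- Range condition for the restricted evolution operator. -/
theorem exists_smul_add_restrictedOp_eq (hP : P.IsProper) (f : SpaceVDual p T V) {s : ℝ}
    (hs : 0 < s) (g : SpaceH T H) :
    ∃ u : P.domain f, s • (u : SpaceH T H) + P.restrictedOp f u = g := by
  have := hP.banach
  obtain ⟨R, hR, hpos⟩ := exists_perturbedOp_pos hP f hs g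
  obtain ⟨u, hu⟩ := hP.isDegenerateSetting.exists_hasNegGenerator
    (isMonotoneOp_perturbedOp hP f hs g) hR hpos
  have hu' : HasTimeDeriv (embDual P.ι (P.M.compLp (embH P.ι u))) (-P.perturbedOp f s g u) := hu
  have hW : u ∈ P.spaceW := ⟨_, hu'⟩
  have h1 := (hasTimeDeriv_iff ⟨_, hW⟩ _).1 hu'
  have hrel : P.CauchyRel f (embH P.ι u) (g - s • embH P.ι u) := by
    refine ⟨⟨u, hW⟩, rfl, ?_⟩
    rw [cauchyOp, h1, ← embDualL_apply, map_sub, map_smul, ← embHL_apply, perturbedOp]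
    abel
  refine ⟨⟨embH P.ι u, _, hrel⟩, ?_⟩
  rw [(cauchyRel_iff hP.denseEmbedding f ⟨embH P.ι u, _, hrel⟩ _).1 hrel]
  simp

end ProblemSet

/-! ### The decomposed operator -/

section Decomposed

variable {p T : ℝ} [Fact (2 ≤ p)] {H V' H' : Type*}
  [NormedAddCommGroup H] [InnerProductSpace ℝ H] [NormedAddCommGroup V'] [NormedSpace ℝ V']
  [NormedAddCommGroup H'] [InnerProductSpace ℝ H'] {P' : ProblemSet p T V' H'}
  {E : H' →L[ℝ] H} {R : H →L[ℝ] H'}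

/-- Moving `E` across the inner product as `R` reduces the claim to the local operator at `R u` and
`R v`. -/
theorem isAccretive_decomposedOp (hP : P'.IsProper) (hER : ∀ u v, ⟪E u, v⟫ = ⟪u, R v⟫)
    (f' : SpaceVDual p T V') :
    IsAccretive (decomposedDomain P' f' R) (decomposedOp P' f' E R) := by
  intro u v
  have h1 := ProblemSet.isAccretive_restrictedOp hP f' ⟨R.compLp (u : SpaceH T H), u.2⟩
    ⟨R.compLp (v : SpaceH T H), v.2⟩
  have h2 : R.compLp ((u : SpaceH T H) - (v : SpaceH T H)) = R.compLp (u : SpaceH T H) - R.compLp (v : SpaceH T H) :=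
    map_sub (R.compLpL 2 (timeMeasure T)) (u : SpaceH T H) (v : SpaceH T H)
  have h3 : decomposedOp P' f' E R u - decomposedOp P' f' E R v
      = E.compLp (P'.restrictedOp f' ⟨R.compLp (u : SpaceH T H), u.2⟩
        - P'.restrictedOp f' ⟨R.compLp (v : SpaceH T H), v.2⟩) :=
    (map_sub (E.compLpL 2 (timeMeasure T)) _ _).symm
  rw [h3, inner_compLp_left hER, h2]
  exact h1

/-- The resolvent of the decomposed operator in terms of a solution of the local problem. -/
theorem exists_resolvent_decomposedOp (hRE : ∀ u, R (E u) = u) (f' : SpaceVDual p T V') {s : ℝ}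
    (hs : 0 < s) (g : SpaceH T H) (ul : P'.domain f')
    (hul : s • (ul : SpaceH T H') + P'.restrictedOp f' ul = R.compLp g) :
    ∃ u : decomposedDomain P' f' R,
      (u : SpaceH T H) = E.compLp (ul : SpaceH T H') + s⁻¹ • (g - E.compLp (R.compLp g)) ∧
      R.compLp (u : SpaceH T H) = ul ∧ s • (u : SpaceH T H) + decomposedOp P' f' E R u = g := by
  set u : SpaceH T H := E.compLp (ul : SpaceH T H') + s⁻¹ • (g - E.compLp (R.compLp g)) with hu
  have hRu : R.compLp u = ul := by
    have h1 : R.compLp u = R.compLp (E.compLp (ul : SpaceH T H'))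
        + s⁻¹ • (R.compLp g - R.compLp (E.compLp (R.compLp g))) := by
      change R.compLpL 2 (timeMeasure T) u = _
      rw [hu, map_add, map_smul, map_sub]
      rfl
    -- `R` annihilates `(I - E R) g`, so the decomposed operator does not see the second summand of
    -- `u`.
    rw [h1, compLp_leftInverse hRE, compLp_leftInverse hRE, sub_self, smul_zero, add_zero]
  have hmem : u ∈ decomposedDomain P' f' R := by
    change R.compLp u ∈ P'.domain f'
    rw [hRu]
    exact ul.2
  refine ⟨⟨u, hmem⟩, rfl, hRu, ?_⟩
  have h2 : decomposedOp P' f' E R ⟨u, hmem⟩ = E.compLp (P'.restrictedOp f' ul) := by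
    have : (⟨R.compLp u, hmem⟩ : P'.domain f') = ul := Subtype.ext hRu
    exact congrArg (fun w => E.compLp (P'.restrictedOp f' w)) this
  have h3 : s • E.compLp (ul : SpaceH T H') + E.compLp (P'.restrictedOp f' ul)
      = E.compLp (R.compLp g) := by
    rw [← hul]
    change _ = E.compLpL 2 (timeMeasure T) _
    rw [map_add, map_smul]
    rfl
  rw [h2]
  change s • u + _ = g
  rw [hu, smul_add, smul_smul, mul_inv_cancel₀ hs.ne', one_smul, add_right_comm, h3]
  abel

end Decomposed

end

end AbstractCauchy

/-- The local unknown ranges over `domain`, a subset of `𝓗_ℓ`. By injectivity of `embH` and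
`embDual`, existence and uniqueness there amount to existence and uniqueness in `𝒲_ℓ`. -/
theorem mainTheorem5 (p T : ℝ) [Fact (2 ≤ p)] (hT : 0 < T) (q : ℕ)
    {V H : Type*} [NormedAddCommGroup V] [NormedSpace ℝ V]
    [NormedAddCommGroup H] [InnerProductSpace ℝ H]
    {Vl Hl : Fin q → Type*} [∀ l, NormedAddCommGroup (Vl l)] [∀ l, NormedSpace ℝ (Vl l)]
    [∀ l, NormedAddCommGroup (Hl l)] [∀ l, InnerProductSpace ℝ (Hl l)]
    (P : AbstractCauchy.ProblemSet p T V H)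
    (Pl : ∀ l, AbstractCauchy.ProblemSet p T (Vl l) (Hl l))
    (E : ∀ l, Hl l →L[ℝ] H) (R : ∀ l, H →L[ℝ] Hl l)
    (hdec : AbstractCauchy.IsDecomposition P Pl E R)
    (f : ∀ l, AbstractCauchy.SpaceVDual p T (Vl l)) (l : Fin q) :
    AbstractCauchy.IsAccretive (AbstractCauchy.decomposedDomain (Pl l) (f l) (R l))
        (AbstractCauchy.decomposedOp (Pl l) (f l) (E l) (R l)) ∧
    AbstractCauchy.IsMaximal (AbstractCauchy.decomposedDomain (Pl l) (f l) (R l))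
        (AbstractCauchy.decomposedOp (Pl l) (f l) (E l) (R l)) ∧
    ∀ s : ℝ, 0 < s → ∀ g : AbstractCauchy.SpaceH T H,
      -- the local problem has a unique solution `ul`
      ∃ ul : (Pl l).domain (f l),
        s • (ul : AbstractCauchy.SpaceH T (Hl l)) + (Pl l).restrictedOp (f l) ul
            = (R l).compLp g ∧
        (∀ vl : (Pl l).domain (f l),
          s • (vl : AbstractCauchy.SpaceH T (Hl l)) + (Pl l).restrictedOp (f l) vl
              = (R l).compLp g → vl = ul) ∧
        -- and `u = E ul + s⁻¹ (I - E R) g` is the resolvent of the decomposed operator at `g`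
        ∃ u : AbstractCauchy.decomposedDomain (Pl l) (f l) (R l),
          (u : AbstractCauchy.SpaceH T H)
            = (E l).compLp (ul : AbstractCauchy.SpaceH T (Hl l))
                + s⁻¹ • (g - (E l).compLp ((R l).compLp g)) ∧
          (R l).compLp (u : AbstractCauchy.SpaceH T H) = ul ∧
          s • (u : AbstractCauchy.SpaceH T H)
              + AbstractCauchy.decomposedOp (Pl l) (f l) (E l) (R l) u = g ∧
          ∀ v : AbstractCauchy.decomposedDomain (Pl l) (f l) (R l),
            s • (v : AbstractCauchy.SpaceH T H)
                + AbstractCauchy.decomposedOp (Pl l) (f l) (E l) (R l) v = g → v = u := by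
  have hP := hdec.proper_local l
  have hacc := AbstractCauchy.isAccretive_decomposedOp hP (hdec.adjoint l) (f l)
  have hres : ∀ s : ℝ, 0 < s → ∀ g : AbstractCauchy.SpaceH T H, _ := fun s hs g =>
    AbstractCauchy.ProblemSet.exists_smul_add_restrictedOp_eq hP (f l) hs ((R l).compLp g)
  refine ⟨hacc, fun s hs => eq_univ_of_forall fun g => ?_, fun s hs g => ?_⟩
  · obtain ⟨ul, hul⟩ := hres s hs g
    obtain ⟨u, -, -, hu⟩ := AbstractCauchy.exists_resolvent_decomposedOp
      (hdec.restrict_extend l) (f l) hs g ul hul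
    exact ⟨u, hu⟩
  · obtain ⟨ul, hul⟩ := hres s hs g
    obtain ⟨u, hu, hRu, hsol⟩ := AbstractCauchy.exists_resolvent_decomposedOp
      (hdec.restrict_extend l) (f l) hs g ul hul
    exact ⟨ul, hul, fun vl hvl => (AbstractCauchy.ProblemSet.isAccretive_restrictedOp hP
      (f l)).eq_of_smul_add_eq hs (hvl.trans hul.symm), u, hu, hRu, hsol,
      fun v hv => hacc.eq_of_smul_add_eq hs (hv.trans hsol.symm)⟩
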